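/- Let $\alpha,\alpha',\beta,\beta',\gamma,\rho,c\in\mathbb C$ and $x>0$. For $f:(0,\infty)\to\mathbb C$ put $$\left(I_{0,-}^{\alpha,\alpha',\beta,\beta',\gamma}f\right)(x)=\frac{x^{-\alpha'}}{\Gamma(\gamma)}\int_x^\infty (t-x)^{\gamma-1}t^{-\alpha}\,F_3\!\left(\alpha,\alpha',\beta,\beta';\gamma;1-\tfrac xt,1-\tfrac tx\right)f(t)\,dt ,$$ where $F_3(a,a',b,b';c;u,v)=\sum_{m,n\ge 0}\frac{(a)_m(a')_n(b)_m(b')_n}{(c)_{m+n}\,m!\,n!}u^mv^n$ for $|u|,|v|<1$, continued analytically to $|u|<1$, $\operatorname{Re}v<\tfrac12$. Let $${}_p\psi_q\!\left[\begin{matrix}(a_i,\alpha_i)_{1,p}\\(b_j,\beta_j)_{1,q}\end{matrix}\Big|z\right]=\sum_{k=0}^\infty\frac{\prod_{i=1}^p\Gamma(a_i+\alpha_ik)}{\prod_{j=1}^q\Gamma(b_j+\beta_jk)}\frac{z^k}{k!}$$ be the generalized Wright function (with $1/\Gamma=0$ at the poles of $\Gamma$), and for $s,z\in\mathbb C$ write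 $$\Psi_s(z)={}_3\psi_4\!\left[\begin{matrix}(s-\gamma+\alpha+\alpha',2),\,(s+\alpha+\beta'-\gamma,2),\,(s-\beta,2)\\(s,2),\,(s-\gamma+\alpha+\alpha'+\beta',2),\,(s+\alpha-\beta,2),\,(\tfrac32,1)\end{matrix}\Big|z\right].$$ Suppose that $\operatorname{Re}\gamma>0$ and $$\operatorname{Re}\rho<\min\{\operatorname{Re}(-\beta),\ \operatorname{Re}(\alpha+\alpha'-\gamma),\ \operatorname{Re}(\alpha+\beta'-\gamma)\}.$$ Then $$\left(I_{0,-}^{\alpha,\alpha',\beta,\beta',\gamma}\,t^{\rho+1}\sin\tfrac ct\right)(x)=\tfrac c2\sqrt\pi\,x^{\rho-\alpha-\alpha'+\gamma}\,\Psi_{-\rho}\!\left(-\tfrac{c^2}{4x^2}\right),$$ $$\left(I_{0,-}^{\alpha,\alpha',\beta,\beta',\gamma}\,t^{\rho+1}\sinh\tfrac ct\right)(x)=\tfrac c2\sqrt\pi\,x^{\rho-\alpha-\alpha'+\gamma}\,\Psi_{-\rho}\!\left(\tfrac{c^2}{4x^2}\right),$$ and likewise, for the powers $t^{\rho-1}$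 and $t^{\rho}$, $$\left(I_{0,-}^{\alpha,\alpha',\beta,\beta',\gamma}\,t^{\rho-1}\sin\tfrac ct\right)(x)=\tfrac c2\sqrt\pi\,x^{\rho-2-\alpha-\alpha'+\gamma}\,\Psi_{2-\rho}\!\left(-\tfrac{c^2}{4x^2}\right),$$ $$\left(I_{0,-}^{\alpha,\alpha',\beta,\beta',\gamma}\,t^{\rho}\sinh\tfrac ct\right)(x)=\tfrac c2\sqrt\pi\,x^{\rho-1-\alpha-\alpha'+\gamma}\,\Psi_{1-\rho}\!\left(\tfrac{c^2}{4x^2}\right).$$ In all four identities the integral converges absolutely and the Wright series converges. -/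

import Mathlib

open MeasureTheory Set

noncomputable section

/-- Pochhammer symbol `(a)_n = a (a + 1) ⋯ (a + n - 1)`. -/
def poch (a : ℂ) (n : ℕ) : ℂ := (ascPochhammer ℂ n).eval a

/-- Principal branch of Gauss's hypergeometric function on the half-plane `Re z < 1/2`, given by
Pfaff's transformation `₂F₁(a,b;c;z) = (1-z)^(-a) ₂F₁(a,c-b;c;z/(z-1))`; the argument `z/(z-1)`
lies in the open unit disc exactly when `Re z < 1/2`. -/
def gaussPfaff (a b c z : ℂ) : ℂ :=
  (1 - z) ^ (-a) * ordinaryHypergeometric a (c - b) c (z / (z - 1))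

/-- The Appell (Horn) function `F₃(a,a',b,b';c;x,y)`. In the bidisc `|x| < 1`, `|y| < 1` it is the
double series `∑ (a)_m (a')_n (b)_m (b')_n / ((c)_{m+n} m! n!) x^m y^n`. Outside of it, on
`|x| < 1`, `Re y < 1/2`, it is the analytic continuation of the double series: summing over `n`
first and using `(c)_{m+n} = (c)_m (c+m)_n` gives
`∑ (a)_m (b)_m / ((c)_m m!) x^m ₂F₁(a',b';c+m;y)`, which is analytic on that (convex) domain. -/
def appellF3 (a a' b b' c x y : ℂ) : ℂ :=
  open Classical in
  if ‖x‖ < 1 ∧ ‖y‖ < 1 then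
    ∑' k : ℕ × ℕ, poch a k.1 * poch a' k.2 * poch b k.1 * poch b' k.2 /
      (poch c (k.1 + k.2) * (k.1.factorial : ℂ) * (k.2.factorial : ℂ)) * x ^ k.1 * y ^ k.2
  else
    ∑' m : ℕ, poch a m * poch b m / (poch c m * (m.factorial : ℂ)) * x ^ m *
      gaussPfaff a' b' (c + m) y

/-- The integrand `(t-x)^(γ-1) t^(-α) F₃(α,α',β,β';γ;1-x/t,1-t/x) f(t)` of the right-sided
Marichev-Saigo-Maeda operator. For `t > x > 0` one has `0 < 1 - x/t < 1` and `1 - t/x < 0`. -/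
def msmIntegrand (α α' β β' γ : ℂ) (f : ℝ → ℂ) (x t : ℝ) : ℂ :=
  ((t - x : ℝ) : ℂ) ^ (γ - 1) * (t : ℂ) ^ (-α) *
    appellF3 α α' β β' γ ((1 - x / t : ℝ) : ℂ) ((1 - t / x : ℝ) : ℂ) * f t

/-- The right-sided Marichev-Saigo-Maeda fractional integral `(I_{0,-}^{α,α',β,β',γ} f)(x)`. -/
def msmRight (α α' β β' γ : ℂ) (f : ℝ → ℂ) (x : ℝ) : ℂ :=
  (x : ℂ) ^ (-α') / Complex.Gamma γ * ∫ t in Ioi x, msmIntegrand α α' β β' γ f x t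

/-- The integral defining `(I_{0,-}^{α,α',β,β',γ} f)(x)` converges absolutely. -/
def MsmRightConverges (α α' β β' γ : ℂ) (f : ℝ → ℂ) (x : ℝ) : Prop :=
  IntegrableOn (msmIntegrand α α' β β' γ f x) (Ioi x)

/-- `k`-th term of the generalized Wright series with upper parameters `(a_i, α_i)` and lower
parameters `(b_j, β_j)`. As `Complex.Gamma` is `0` at its poles and division by `0` gives `0`, a
pole in the denominator contributes `1/Γ = 0`, as usual. -/
def wrightTerm {p q : ℕ} (a : Fin p → ℂ × ℝ) (b : Fin q → ℂ × ℝ) (z : ℂ) (k : ℕ) : ℂ :=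
  (∏ i, Complex.Gamma ((a i).1 + (a i).2 * k)) / (∏ j, Complex.Gamma ((b j).1 + (b j).2 * k)) *
    (z ^ k / (k.factorial : ℂ))

/-- The generalized Wright function `_pψ_q`. -/
def wrightPsi {p q : ℕ} (a : Fin p → ℂ × ℝ) (b : Fin q → ℂ × ℝ) (z : ℂ) : ℂ :=
  ∑' k : ℕ, wrightTerm a b z k

/-- Upper parameters `(s-γ+α+α',2), (s+α+β'-γ,2), (s-β,2)`. -/
def upperParams (α α' β β' γ s : ℂ) : Fin 3 → ℂ × ℝ :=
  ![(s - γ + α + α', 2), (s + α + β' - γ, 2), (s - β, 2)]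

/-- Lower parameters `(s,2), (s-γ+α+α'+β',2), (s+α-β,2), (3/2,1)`. -/
def lowerParams (α α' β β' γ s : ℂ) : Fin 4 → ℂ × ℝ :=
  ![(s, 2), (s - γ + α + α' + β', 2), (s + α - β, 2), (3 / 2, 1)]

/-- `(I_{0,-} f)(x) = C · ₃ψ₄[upper; lower | z]`, with the integral absolutely convergent and the
Wright series convergent. -/
def HasMsmImage (α α' β β' γ : ℂ) (f : ℝ → ℂ) (x : ℝ) (C s z : ℂ) : Prop :=
  MsmRightConverges α α' β β' γ f x ∧
  Summable (wrightTerm (upperParams α α' β β' γ s) (lowerParams α α' β β' γ s) z) ∧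
  msmRight α α' β β' γ f x =
    C * wrightPsi (upperParams α α' β β' γ s) (lowerParams α α' β β' γ s) z

end

/-!
The operator `I_{0,-}` is a Mellin convolution, so it maps `t ^ p` to a multiple of a power of `x`,
the multiple being a quotient of Gamma functions; expanding `sin (c / t)` and `sinh (c / t)` in
powers of `1 / t` and integrating term by term then gives the Wright series, with the odd factorials
turned into `Γ(3 / 2 + k) k!` by the duplication formula (`wrightTerm_eq`,
`hasMsmImage_of_hasSum`). The work is in the image of a single power, on the whole range of
exponents, including the absolute convergence of the integral.

With `u = x / t` and `w = 1 - u`, Pfaff's transformation in the second variable turns `F₃` into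
`u ^ a'` times a double power series `G(w) = kernelSeries a a' b b' c w`
(`appellF3_eq_kernelSeries`); on the part of the range where `F₃` is defined by its double series
this needs Pfaff's transformation only for `0 ≤ w < 1 / 2`, where a rearrangement of an absolutely
convergent double series proves it (`pfaff`). The integral becomes the Mellin transform of
`(1 - u) ^ (c - 1) G(1 - u)` on `(0, 1)`.

For a parameter `s` of large real part the Mellin transform may be computed term by term, and two
applications of Gauss's theorem evaluate the double sum (`exists_mellin_msmKernel_eq`). On the full
half-plane of the hypotheses the double sum need not converge absolutely, so the identity is carried
over by analytic continuation in `s` (`hasMellin_msmKernel`). This requires the true order of growth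
of `G` at `w = 1`, namely `G(w) = O((1 - w) ^ (-κ))` for every
`κ > max 0 (max (Re (a' - b')) (Re (a + a' + b - c)))`. If `Re a' ≥ 1` this bound can be read off
from the absolute values of the coefficients (`exists_summable_bound_kernelCoeff`); the contiguity
relation `kernelSeries_contiguous` reduces every other case to that one
(`exists_norm_kernelSeries_le`).
-/

/-! ### Pochhammer symbols: identities and growth -/

theorem poch_zero (a : ℂ) : poch a 0 = 1 := by simp [poch]

theorem poch_succ (a : ℂ) (n : ℕ) : poch a (n + 1) = poch a n * (a + n) := by
  simp [poch, ascPochhammer_succ_eval]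

theorem poch_succ_left (a : ℂ) (n : ℕ) : poch a (n + 1) = a * poch (a + 1) n := by
  simp [poch, ascPochhammer_succ_left]

theorem poch_add (a : ℂ) (m n : ℕ) : poch a (m + n) = poch a m * poch (a + m) n := by
  induction n with
  | zero => simp [poch_zero]
  | succ n ih => rw [← add_assoc, poch_succ, ih, poch_succ]; push_cast; ring

theorem ne_zero_of_re_pos {z : ℂ} (h : 0 < z.re) : z ≠ 0 := by
  rintro rfl; simp at h

theorem poch_ne_zero {c : ℂ} (hc : 0 < c.re) (n : ℕ) : poch c n ≠ 0 := by
  induction n with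
  | zero => simp [poch_zero]
  | succ n ih =>
    rw [poch_succ]
    refine mul_ne_zero ih (ne_zero_of_re_pos ?_)
    simp; positivity

theorem Gamma_add_nat {c : ℂ} (hc : 0 < c.re) (n : ℕ) :
    Complex.Gamma (c + n) = poch c n * Complex.Gamma c := by
  induction n with
  | zero => simp [poch_zero]
  | succ n ih =>
    have : c + n ≠ 0 := ne_zero_of_re_pos (by simp; positivity)
    rw [Nat.cast_succ, ← add_assoc, Complex.Gamma_add_one _ this, ih, poch_succ]; ring

theorem abs_log_one_add_sub_le {y : ℝ} (h0 : 0 ≤ y) : |Real.log (1 + y) - y| ≤ y ^ 2 := by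
  have h1 : Real.log (1 + y) ≤ y := by
    have := Real.log_le_sub_one_of_pos (show 0 < 1 + y by linarith); linarith
  have h2 : y - y ^ 2 ≤ Real.log (1 + y) := by
    have h := Real.one_sub_inv_le_log_of_pos (show 0 < 1 + y by linarith)
    have : y - y ^ 2 ≤ 1 - (1 + y)⁻¹ := by
      have h3 : 1 - (1 + y)⁻¹ = y / (1 + y) := by field_simp; ring
      rw [h3, le_div_iff₀ (by linarith)]
      nlinarith [pow_nonneg h0 3]
    linarith
  rw [abs_le]; constructor <;> linarith

/-- First-order comparison of an exponential with a power of `1 + y`. -/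
theorem exp_mul_le_rpow_mul_exp (r : ℝ) {y : ℝ} (h0 : 0 ≤ y) :
    Real.exp (r * y) ≤ (1 + y) ^ r * Real.exp (|r| * y ^ 2) := by
  rw [Real.rpow_def_of_pos (by linarith), ← Real.exp_add, Real.exp_le_exp]
  have := mul_le_mul_of_nonneg_left (abs_log_one_add_sub_le h0) (abs_nonneg r)
  rw [← abs_mul, abs_le] at this
  nlinarith [this.1]

theorem norm_one_add_le_exp (z : ℂ) : ‖1 + z‖ ≤ Real.exp (z.re + ‖z‖ ^ 2) := by
  have h : ‖1 + z‖ ^ 2 ≤ (Real.exp (z.re + ‖z‖ ^ 2)) ^ 2 := by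
    rw [← Real.exp_nat_mul, Complex.sq_norm, Complex.normSq_apply]
    have h1 := Real.add_one_le_exp (((2 : ℕ) : ℝ) * (z.re + ‖z‖ ^ 2))
    refine le_trans ?_ h1
    rw [Complex.sq_norm, Complex.normSq_apply]
    simp
    nlinarith [sq_nonneg z.re, sq_nonneg z.im]
  exact le_of_sq_le_sq h (Real.exp_pos _).le

/-- A sequence whose consecutive ratios are those of `n ↦ (m + n + 1) ^ r`, up to the factors
`exp (D / (m + n + 1) ^ 2)` of a convergent product, grows at most like `(m + n + 1) ^ r`, with a
constant that does not depend on `m`. -/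
theorem le_rpow_of_ratio_le {a : ℕ → ℝ} {r D : ℝ} (hD : 0 ≤ D) (m : ℕ) (ha : ∀ n, 0 ≤ a n)
    (h : ∀ n : ℕ, a (n + 1) ≤ a n * ((1 + 1 / ((m : ℝ) + n + 1)) ^ r *
      Real.exp (D * (1 / ((m : ℝ) + n + 1)) ^ 2))) (n : ℕ) :
    a n ≤ a 0 * (Real.exp (2 * D) * (((m : ℝ) + n + 1) / (m + 1)) ^ r) := by
  have key : ∀ n : ℕ, a n ≤ a 0 * (Real.exp (2 * D * (1 / ((m : ℝ) + 1) - 1 / (m + n + 1))) *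
      (((m : ℝ) + n + 1) / (m + 1)) ^ r) := by
    intro n
    induction n with
    | zero => simp [div_self (show (m : ℝ) + 1 ≠ 0 by positivity)]
    | succ n ih =>
      have hp : (0 : ℝ) < (m : ℝ) + n + 1 := by positivity
      refine (h n).trans ((mul_le_mul_of_nonneg_right ih (by positivity)).trans ?_)
      have e1 : (((m : ℝ) + (n + 1 : ℕ) + 1) / (m + 1)) ^ r =
          (((m : ℝ) + n + 1) / (m + 1)) ^ r * (1 + 1 / ((m : ℝ) + n + 1)) ^ r := by
        rw [← Real.mul_rpow (by positivity) (by positivity)]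
        congr 1; push_cast; field_simp; ring
      have e2 : Real.exp (2 * D * (1 / ((m : ℝ) + 1) - 1 / (m + n + 1))) *
          Real.exp (D * (1 / ((m : ℝ) + n + 1)) ^ 2) ≤
          Real.exp (2 * D * (1 / ((m : ℝ) + 1) - 1 / (m + (n + 1 : ℕ) + 1))) := by
        rw [← Real.exp_add, Real.exp_le_exp]
        have h3 : (1 / ((m : ℝ) + n + 1)) ^ 2 ≤
            2 * (1 / ((m : ℝ) + n + 1) - 1 / (m + (n + 1 : ℕ) + 1)) := by
          have h4 : 2 * (1 / ((m : ℝ) + n + 1) - 1 / (m + (n + 1 : ℕ) + 1)) =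
            2 / (((m : ℝ) + n + 1) * (m + n + 2)) := by push_cast; field_simp; ring
          rw [h4, one_div, inv_pow, ← one_div, div_le_div_iff₀ (by positivity) (by positivity)]
          nlinarith
        nlinarith
      rw [e1]
      calc _ = a 0 * ((Real.exp (2 * D * (1 / ((m : ℝ) + 1) - 1 / (m + n + 1))) *
            Real.exp (D * (1 / ((m : ℝ) + n + 1)) ^ 2)) * ((((m : ℝ) + n + 1) / (m + 1)) ^ r *
            (1 + 1 / ((m : ℝ) + n + 1)) ^ r)) := by ring
        _ ≤ _ := by
          have := ha 0
          gcongr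
  refine (key n).trans (mul_le_mul_of_nonneg_left
    (mul_le_mul_of_nonneg_right (Real.exp_le_exp.2 ?_) (by positivity)) (ha 0))
  have h1 : 1 / ((m : ℝ) + 1) ≤ 1 := by
    rw [div_le_one (by positivity)]; linarith [Nat.cast_nonneg (α := ℝ) m]
  have h2 : (0 : ℝ) ≤ 1 / (m + n + 1) := by positivity
  nlinarith

/-- Growth of `(q + m)_n`, uniformly in `m`. -/
theorem exists_norm_poch_shift_le (q : ℂ) : ∃ C : ℝ, 0 < C ∧ ∀ m n : ℕ,
    ‖poch (q + m) n‖ ≤ C * (((m + n).factorial : ℝ) / m.factorial) *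
      (((m : ℝ) + n + 1) / (m + 1)) ^ (q.re - 1) := by
  set D : ℝ := ‖q - 1‖ ^ 2 + |q.re - 1| with hD
  refine ⟨Real.exp (2 * D), Real.exp_pos _, fun m n => ?_⟩
  have hf : ∀ k : ℕ, (0 : ℝ) < k.factorial := fun k => by exact_mod_cast k.factorial_pos
  have := le_rpow_of_ratio_le (a := fun n => ‖poch (q + m) n‖ * m.factorial / (m + n).factorial)
    (r := q.re - 1) (D := D) (by positivity) m (fun n => by positivity) ?_ n
  · simp only [poch_zero, norm_one, add_zero, one_mul, div_self (hf m).ne'] at this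
    rw [div_le_iff₀ (hf _)] at this
    rw [mul_div_assoc', div_mul_eq_mul_div, le_div_iff₀ (hf m)]
    refine this.trans (le_of_eq (by ring))
  · intro n
    have hy : (0 : ℝ) < (m : ℝ) + n + 1 := by positivity
    have hyc : ((m : ℂ) + n + 1) ≠ 0 := by exact_mod_cast hy.ne'
    have e : q + m + n = ((m : ℂ) + n + 1) * (1 + (q - 1) / ((m : ℂ) + n + 1)) := by
      field_simp; ring
    have e2 : ‖(m : ℂ) + n + 1‖ = (m : ℝ) + n + 1 := by
      rw [show (m : ℂ) + n + 1 = (((m : ℝ) + n + 1 : ℝ) : ℂ) by push_cast; rfl,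
        Complex.norm_real, Real.norm_of_nonneg hy.le]
    have e3 : ((q - 1) / ((m : ℂ) + n + 1)).re = (q.re - 1) * (1 / ((m : ℝ) + n + 1)) := by
      rw [show (m : ℂ) + n + 1 = (((m : ℝ) + n + 1 : ℝ) : ℂ) by push_cast; rfl,
        Complex.div_ofReal_re]; simp; ring
    have hb : ‖q + m + n‖ ≤ ((m : ℝ) + n + 1) * ((1 + 1 / ((m : ℝ) + n + 1)) ^ (q.re - 1) *
      Real.exp (D * (1 / ((m : ℝ) + n + 1)) ^ 2)) := by
      rw [e, norm_mul, e2]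
      refine mul_le_mul_of_nonneg_left ((norm_one_add_le_exp _).trans ?_) hy.le
      rw [e3, norm_div, e2, Real.exp_add]
      refine (mul_le_mul_of_nonneg_right (exp_mul_le_rpow_mul_exp _ (by positivity))
        (Real.exp_pos _).le).trans ?_
      rw [mul_assoc, ← Real.exp_add]
      refine le_of_eq ?_
      congr 2; rw [hD]; ring
    show ‖poch (q + m) (n + 1)‖ * _ / ((m + n + 1).factorial : ℕ) ≤ _
    rw [poch_succ, norm_mul, Nat.factorial_succ, div_le_iff₀ (by positivity)]
    push_cast
    calc _ ≤ ‖poch (q + m) n‖ * (((m : ℝ) + n + 1) * ((1 + 1 / ((m : ℝ) + n + 1)) ^ (q.re - 1) *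
      Real.exp (D * (1 / ((m : ℝ) + n + 1)) ^ 2))) * m.factorial := by gcongr
      _ = _ := by have := (hf (m + n)).ne'; field_simp

theorem exists_norm_poch_le (q : ℂ) : ∃ C : ℝ, 0 < C ∧ ∀ n : ℕ,
    ‖poch q n‖ ≤ C * n.factorial * ((n : ℝ) + 1) ^ (q.re - 1) := by
  obtain ⟨C, hC, h⟩ := exists_norm_poch_shift_le q
  refine ⟨C, hC, fun n => ?_⟩
  simpa using h 0 n

theorem re_le_norm_add_nat {c : ℂ} (k : ℕ) : c.re + k ≤ ‖c + k‖ := by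
  simpa using Complex.re_le_norm (c + k)

/-- Lower bound for `(c)_n` in the right half-plane. -/
theorem exists_factorial_div_norm_poch_le {c : ℂ} (hc : 0 < c.re) : ∃ C : ℝ, 0 < C ∧ ∀ n : ℕ,
    (n.factorial : ℝ) / ‖poch c n‖ ≤ C * ((n : ℝ) + 1) ^ (1 - c.re) := by
  set g := c.re with hg
  set D : ℝ := (1 - g) ^ 2 * (1 + 1 / g) + |1 - g| with hD
  refine ⟨Real.exp (2 * D), Real.exp_pos _, fun n => ?_⟩
  have := le_rpow_of_ratio_le (a := fun n => (n.factorial : ℝ) / ‖poch c n‖)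
    (r := 1 - g) (D := D) (by positivity) 0 (fun n => by positivity) ?_ n
  · simpa [poch_zero] using this
  · intro k
    have hk : (0 : ℝ) < (k : ℝ) + 1 := by positivity
    have hkg : 0 < g + k := by positivity
    have hpos : 0 < ‖poch c k‖ := norm_pos_iff.2 (poch_ne_zero hc k)
    have hb : ((k : ℝ) + 1) / ‖c + k‖ ≤ (1 + 1 / ((k : ℝ) + 1)) ^ (1 - g) *
        Real.exp (D * (1 / ((k : ℝ) + 1)) ^ 2) := by
      have h1 : ((k : ℝ) + 1) / ‖c + k‖ ≤ (k + 1) / (g + k) :=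
        div_le_div_of_nonneg_left hk.le hkg (re_le_norm_add_nat k)
      have h2 : ((k : ℝ) + 1) / (g + k) ≤ Real.exp ((1 - g) / (g + k)) := by
        have := Real.add_one_le_exp ((1 - g) / (g + k))
        refine le_trans (le_of_eq ?_) this
        field_simp; ring
      have h3 : (1 - g) / (g + k) ≤ (1 - g) * (1 / ((k : ℝ) + 1)) +
          ((1 - g) ^ 2 * (1 + 1 / g)) * (1 / ((k : ℝ) + 1)) ^ 2 := by
        have h4 : 1 / (g + k) ≤ (1 + 1 / g) * (1 / ((k : ℝ) + 1)) := by
          have : (1 + 1 / g) * (1 / ((k : ℝ) + 1)) = (g + 1) / (g * (k + 1)) := by field_simp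
          rw [this, div_le_div_iff₀ hkg (by positivity)]
          nlinarith [mul_nonneg hc.le (Nat.cast_nonneg (α := ℝ) k), Nat.cast_nonneg (α := ℝ) k]
        have h5 : (1 - g) / (g + k) = (1 - g) * (1 / ((k : ℝ) + 1)) +
          (1 - g) ^ 2 * (1 / ((k : ℝ) + 1)) * (1 / (g + k)) := by field_simp; ring
        rw [h5]
        have : (1 - g) ^ 2 * (1 / ((k : ℝ) + 1)) * (1 / (g + k)) ≤
          (1 - g) ^ 2 * (1 / ((k : ℝ) + 1)) * ((1 + 1 / g) * (1 / ((k : ℝ) + 1))) := by gcongr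
        nlinarith
      refine h1.trans (h2.trans ((Real.exp_le_exp.2 h3).trans ?_))
      rw [Real.exp_add]
      refine (mul_le_mul_of_nonneg_right (exp_mul_le_rpow_mul_exp _ (by positivity))
        (Real.exp_pos _).le).trans ?_
      rw [mul_assoc, ← Real.exp_add]
      refine le_of_eq ?_
      congr 2; rw [hD]; ring
    simp only [Nat.cast_zero, zero_add]
    rw [poch_succ, norm_mul, Nat.factorial_succ]
    push_cast
    calc _ = (k.factorial : ℝ) / ‖poch c k‖ * (((k : ℝ) + 1) / ‖c + k‖) := by
          rw [div_mul_div_comm]; ring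
      _ ≤ _ := mul_le_mul_of_nonneg_left hb (by positivity)

/-! ### The double series of the kernel -/

/-- Coefficient of `w ^ (m + n)` in the expansion, around `w = 0`, of the kernel
`(1 - w) ^ (-a') F₃(a, a', b, b'; c; w, w / (w - 1))`. It arises from the definition of `F₃` by
Pfaff's transformation in the second variable. -/
noncomputable def kernelCoeff (a a' b b' c : ℂ) (k : ℕ × ℕ) : ℂ :=
  poch a k.1 * poch b k.1 * poch a' k.2 * poch (c - b' + k.1) k.2 /
    (poch c (k.1 + k.2) * (k.1.factorial : ℂ) * (k.2.factorial : ℂ))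

/-- The function `(1 - w) ^ (-a') F₃(a, a', b, b'; c; w, w / (w - 1))` for real `w ∈ [0, 1)`, as a
double power series. -/
noncomputable def kernelSeries (a a' b b' c : ℂ) (w : ℝ) : ℂ :=
  ∑' k : ℕ × ℕ, kernelCoeff a a' b b' c k * (w : ℂ) ^ (k.1 + k.2)

theorem rpow_le_exp_mul {κ x : ℝ} (hκ : 0 < κ) (hx : 0 ≤ x) : x ^ κ ≤ κ ^ κ * Real.exp x := by
  have h1 : x / κ ≤ Real.exp (x / κ) := by linarith [Real.add_one_le_exp (x / κ)]
  have h2 := Real.rpow_le_rpow (by positivity) h1 hκ.le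
  rw [Real.div_rpow hx hκ.le, ← Real.exp_mul, div_mul_cancel₀ _ hκ.ne',
    div_le_iff₀ (by positivity)] at h2
  linarith

theorem exists_rpow_mul_pow_le {κ : ℝ} (hκ : 0 < κ) : ∃ C : ℝ, 0 < C ∧ ∀ (N : ℕ) (w : ℝ),
    0 ≤ w → w < 1 → ((N : ℝ) + 1) ^ κ * w ^ N ≤ C * (1 - w) ^ (-κ) := by
  refine ⟨κ ^ κ * Real.exp 1, by positivity, fun N w h0 h1 => ?_⟩
  have hu : 0 < 1 - w := by linarith
  have h2 : w ^ N ≤ Real.exp (-(1 - w) * N) := by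
    rw [mul_comm, Real.exp_nat_mul]
    refine pow_le_pow_left₀ h0 ?_ _
    have := Real.add_one_le_exp (-(1 - w)); linarith
  have h3 := rpow_le_exp_mul hκ (show 0 ≤ ((N : ℝ) + 1) * (1 - w) by positivity)
  rw [Real.mul_rpow (by positivity) hu.le] at h3
  rw [Real.rpow_neg hu.le, ← div_eq_mul_inv, le_div_iff₀ (by positivity)]
  calc _ = (((N : ℝ) + 1) ^ κ * (1 - w) ^ κ) * w ^ N := by ring
    _ ≤ (κ ^ κ * Real.exp (((N : ℝ) + 1) * (1 - w))) * Real.exp (-(1 - w) * N) := by gcongr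
    _ = κ ^ κ * Real.exp (1 - w) := by rw [mul_assoc, ← Real.exp_add]; congr 2; ring
    _ ≤ _ := by gcongr; linarith

theorem exists_norm_kernelCoeff_le (a a' b b' : ℂ) {c : ℂ} (hc : 0 < c.re) :
    ∃ C : ℝ, 0 < C ∧ ∀ m n : ℕ, ‖kernelCoeff a a' b b' c (m, n)‖ ≤
      C * (((m : ℝ) + 1) ^ (a.re + b.re - c.re + b'.re - 1) * ((n : ℝ) + 1) ^ (a'.re - 1) *
        ((m : ℝ) + n + 1) ^ (-b'.re)) := by
  obtain ⟨C₁, h₁, H₁⟩ := exists_norm_poch_le a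
  obtain ⟨C₂, h₂, H₂⟩ := exists_norm_poch_le b
  obtain ⟨C₃, h₃, H₃⟩ := exists_norm_poch_le a'
  obtain ⟨C₄, h₄, H₄⟩ := exists_norm_poch_shift_le (c - b')
  obtain ⟨C₅, h₅, H₅⟩ := exists_factorial_div_norm_poch_le hc
  refine ⟨C₁ * C₂ * C₃ * C₄ * C₅, by positivity, fun m n => ?_⟩
  have hf : ∀ k : ℕ, (0 : ℝ) < k.factorial := fun k => by exact_mod_cast k.factorial_pos
  have hM : (0 : ℝ) < (m : ℝ) + 1 := by positivity
  have hN : (0 : ℝ) < (n : ℝ) + 1 := by positivity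
  have hT : (0 : ℝ) < (m : ℝ) + n + 1 := by positivity
  have H5 := H₅ (m + n)
  push_cast at H5
  have hm := (hf m).ne'
  have hn := (hf n).ne'
  have hmn := (hf (m + n)).ne'
  have hp : ‖poch c (m + n)‖ ≠ 0 := norm_ne_zero_iff.2 (poch_ne_zero hc _)
  have e1 : ‖kernelCoeff a a' b b' c (m, n)‖ = ‖poch a m‖ * ‖poch b m‖ * ‖poch a' n‖ *
      ‖poch (c - b' + m) n‖ * (((m + n).factorial : ℝ) / ‖poch c (m + n)‖) *
        (1 / ((m + n).factorial * m.factorial * n.factorial)) := by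
    simp only [kernelCoeff, norm_div, norm_mul, Complex.norm_natCast]
    field_simp
  rw [e1]
  calc _ ≤ (C₁ * m.factorial * ((m : ℝ) + 1) ^ (a.re - 1)) *
        (C₂ * m.factorial * ((m : ℝ) + 1) ^ (b.re - 1)) *
        (C₃ * n.factorial * ((n : ℝ) + 1) ^ (a'.re - 1)) *
        (C₄ * (((m + n).factorial : ℝ) / m.factorial) *
          (((m : ℝ) + n + 1) / (m + 1)) ^ ((c - b').re - 1)) *
        (C₅ * ((m : ℝ) + n + 1) ^ (1 - c.re)) *
        (1 / ((m + n).factorial * m.factorial * n.factorial)) := by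
        gcongr
        exacts [H₁ m, H₂ m, H₃ n, H₄ m n]
    _ = C₁ * C₂ * C₃ * C₄ * C₅ * ((((m : ℝ) + 1) ^ (a.re - 1) * ((m : ℝ) + 1) ^ (b.re - 1) /
          ((m : ℝ) + 1) ^ ((c - b').re - 1)) * ((n : ℝ) + 1) ^ (a'.re - 1) *
          (((m : ℝ) + n + 1) ^ ((c - b').re - 1) * ((m : ℝ) + n + 1) ^ (1 - c.re))) := by
        rw [Real.div_rpow hT.le hM.le]; field_simp
    _ = _ := by
        rw [← Real.rpow_add hM, ← Real.rpow_sub hM, ← Real.rpow_add hT]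
        rw [Complex.sub_re,
          show a.re - 1 + (b.re - 1) - (c.re - b'.re - 1) = a.re + b.re - c.re + b'.re - 1 by ring,
          show c.re - b'.re - 1 + (1 - c.re) = -b'.re by ring]

/-- The terms of the double series are dominated, uniformly in `w`, by a summable family times
`(1 - w) ^ (-κ)`. The exponent is the true order of growth of the series as `w → 1` when
`Re a' ≥ 1`, where one may take `r = Re a'`. -/
theorem exists_summable_bound_kernelCoeff {a a' b b' c : ℂ} (hc : 0 < c.re) {r κ : ℝ}
    (hr : a'.re ≤ r) (hr1 : 1 ≤ r) (hκ : 0 < κ) (hκ1 : r - b'.re < κ)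
    (hκ2 : a.re + r + b.re - c.re < κ) :
    ∃ S : ℕ × ℕ → ℝ, Summable S ∧ (∀ k, 0 ≤ S k) ∧ ∀ k, ∀ w : ℝ, 0 ≤ w → w < 1 →
      ‖kernelCoeff a a' b b' c k‖ * w ^ (k.1 + k.2) ≤ (1 - w) ^ (-κ) * S k := by
  obtain ⟨C, hC, H⟩ := exists_norm_kernelCoeff_le a a' b b' hc
  obtain ⟨D, hD, HD⟩ := exists_rpow_mul_pow_le hκ
  set P := a.re + b.re - c.re + b'.re with hP
  -- One `ε` each is spent on the summability in `m` and in `n`.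
  obtain ⟨ε, hε, hε1⟩ : ∃ ε : ℝ, 0 < ε ∧ max P 0 + 2 * ε + r - b'.re ≤ κ := by
    refine ⟨(κ - (max P 0 + r - b'.re)) / 2, ?_, by linarith⟩
    have : max P 0 + r - b'.re < κ := by
      rcases max_cases P 0 with ⟨h, -⟩ | ⟨h, -⟩ <;> rw [h] <;> linarith
    linarith
  have hs : Summable fun n : ℕ => ((n : ℝ) + 1) ^ (-1 - ε) := by
    have := (summable_nat_add_iff 1).2 (Real.summable_nat_rpow.2 (show -1 - ε < -1 by linarith))
    simpa using this
  refine ⟨fun k => C * D * (((k.1 : ℝ) + 1) ^ (-1 - ε) * ((k.2 : ℝ) + 1) ^ (-1 - ε)), ?_, ?_, ?_⟩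
  · exact (hs.mul_of_nonneg hs (fun _ => by positivity) (fun _ => by positivity)).mul_left _
  · intro k; positivity
  · rintro ⟨m, n⟩ w h0 h1
    have hM : (1 : ℝ) ≤ (m : ℝ) + 1 := by simp
    have hN : (1 : ℝ) ≤ (n : ℝ) + 1 := by simp
    have hMT : (m : ℝ) + 1 ≤ (m : ℝ) + n + 1 := by
      linarith [Nat.cast_nonneg (α := ℝ) n]
    have hNT : (n : ℝ) + 1 ≤ (m : ℝ) + n + 1 := by
      linarith [Nat.cast_nonneg (α := ℝ) m]
    have hT : (1 : ℝ) ≤ (m : ℝ) + n + 1 := hM.trans hMT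
    have hT0 : (0 : ℝ) < (m : ℝ) + n + 1 := by linarith
    have hM0 : (0 : ℝ) < (m : ℝ) + 1 := by linarith
    have hN0 : (0 : ℝ) < (n : ℝ) + 1 := by linarith
    have b1 : ((n : ℝ) + 1) ^ (a'.re - 1) ≤ ((m : ℝ) + n + 1) ^ (r - 1) :=
      (Real.rpow_le_rpow_of_exponent_le hN (by linarith)).trans
        (Real.rpow_le_rpow (by linarith) hNT (by linarith))
    have b2 : ((m : ℝ) + 1) ^ (P - 1) ≤
        ((m : ℝ) + 1) ^ (-1 - ε) * ((m : ℝ) + n + 1) ^ (max P 0 + ε) := by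
      have : ((m : ℝ) + 1) ^ (P - 1) = ((m : ℝ) + 1) ^ (-1 - ε) * ((m : ℝ) + 1) ^ (P + ε) := by
        rw [← Real.rpow_add hM0]; congr 1; ring
      rw [this]
      gcongr
      exact (Real.rpow_le_rpow_of_exponent_le hM (by linarith [le_max_left P 0])).trans
        (Real.rpow_le_rpow hM0.le hMT (by linarith [le_max_right P 0]))
    have b3 : ((m : ℝ) + n + 1) ^ (max P 0 + ε) * ((m : ℝ) + n + 1) ^ (r - 1) *
        ((m : ℝ) + n + 1) ^ (-b'.re) ≤ ((n : ℝ) + 1) ^ (-1 - ε) * ((m : ℝ) + n + 1) ^ κ := by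
      have : ((m : ℝ) + n + 1) ^ (-1 - ε) ≤ ((n : ℝ) + 1) ^ (-1 - ε) :=
        Real.rpow_le_rpow_of_nonpos hN0 hNT (by linarith)
      refine le_trans ?_ (mul_le_mul_of_nonneg_right this (by positivity))
      rw [← Real.rpow_add hT0, ← Real.rpow_add hT0, ← Real.rpow_add hT0]
      exact Real.rpow_le_rpow_of_exponent_le hT (by linarith)
    have b4 := HD (m + n) w h0 h1
    push_cast at b4
    calc _ ≤ C * (((m : ℝ) + 1) ^ (P - 1) * ((n : ℝ) + 1) ^ (a'.re - 1) *
        ((m : ℝ) + n + 1) ^ (-b'.re)) * w ^ (m + n) := by gcongr; exact H m n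
      _ ≤ C * ((((m : ℝ) + 1) ^ (-1 - ε) * ((m : ℝ) + n + 1) ^ (max P 0 + ε)) *
        ((m : ℝ) + n + 1) ^ (r - 1) * ((m : ℝ) + n + 1) ^ (-b'.re)) * w ^ (m + n) := by gcongr
      _ = C * ((m : ℝ) + 1) ^ (-1 - ε) * (((m : ℝ) + n + 1) ^ (max P 0 + ε) *
        ((m : ℝ) + n + 1) ^ (r - 1) * ((m : ℝ) + n + 1) ^ (-b'.re)) * w ^ (m + n) := by ring
      _ ≤ C * ((m : ℝ) + 1) ^ (-1 - ε) * (((n : ℝ) + 1) ^ (-1 - ε) *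
        ((m : ℝ) + n + 1) ^ κ) * w ^ (m + n) := by gcongr
      _ = C * ((m : ℝ) + 1) ^ (-1 - ε) * ((n : ℝ) + 1) ^ (-1 - ε) *
        (((m : ℝ) + n + 1) ^ κ * w ^ (m + n)) := by ring
      _ ≤ C * ((m : ℝ) + 1) ^ (-1 - ε) * ((n : ℝ) + 1) ^ (-1 - ε) *
        (D * (1 - w) ^ (-κ)) := by gcongr
      _ = _ := by ring

theorem exists_crude_bound_kernelCoeff (a a' b b' : ℂ) {c : ℂ} (hc : 0 < c.re) :
    ∃ κ : ℝ, 0 < κ ∧ ∃ S : ℕ × ℕ → ℝ, Summable S ∧ (∀ k, 0 ≤ S k) ∧ ∀ k, ∀ w : ℝ, 0 ≤ w → w < 1 →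
      ‖kernelCoeff a a' b b' c k‖ * w ^ (k.1 + k.2) ≤ (1 - w) ^ (-κ) * S k := by
  set r := max a'.re 1
  set κ := max 0 (max (r - b'.re) (a.re + r + b.re - c.re)) + 1 with hκ
  have h1 := le_max_left 0 (max (r - b'.re) (a.re + r + b.re - c.re))
  have h2 := le_max_right 0 (max (r - b'.re) (a.re + r + b.re - c.re))
  have h3 := le_max_left (r - b'.re) (a.re + r + b.re - c.re)
  have h4 := le_max_right (r - b'.re) (a.re + r + b.re - c.re)
  exact ⟨κ, by linarith, exists_summable_bound_kernelCoeff hc (le_max_left _ _) (le_max_right _ _)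
    (by linarith) (by linarith) (by linarith)⟩

theorem summable_kernelCoeff (a a' b b' : ℂ) {c : ℂ} (hc : 0 < c.re) {w : ℝ} (h0 : 0 ≤ w)
    (h1 : w < 1) :
    Summable fun k : ℕ × ℕ => kernelCoeff a a' b b' c k * (w : ℂ) ^ (k.1 + k.2) := by
  obtain ⟨κ, -, S, hS, -, H⟩ := exists_crude_bound_kernelCoeff a a' b b' hc
  refine Summable.of_norm_bounded (hS.mul_left ((1 - w) ^ (-κ))) fun k => ?_
  simpa [abs_of_nonneg h0] using H k w h0 h1

theorem continuousOn_kernelSeries (a a' b b' : ℂ) {c : ℂ} (hc : 0 < c.re) :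
    ContinuousOn (kernelSeries a a' b b' c) (Ico 0 1) := by
  obtain ⟨κ, -, S, hS, -, H⟩ := exists_crude_bound_kernelCoeff a a' b b' hc
  intro w hw
  obtain ⟨v, hwv, hv⟩ := exists_between hw.2
  have : ContinuousOn (kernelSeries a a' b b' c) (Icc 0 v) := by
    refine continuousOn_tsum (u := fun k => (1 - v) ^ (-κ) * S k) (fun k => ?_)
      (hS.mul_left _) fun k x hx => ?_
    · fun_prop
    · refine le_trans ?_ (H k v (hx.1.trans hx.2) hv)
      rw [norm_mul, norm_pow, Complex.norm_real, Real.norm_of_nonneg hx.1]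
      gcongr
      exacts [hx.1, hx.2]
  refine (this w ⟨hw.1, hwv.le⟩).mono_of_mem_nhdsWithin ?_
  have h := inter_mem_nhdsWithin (Ico (0 : ℝ) 1) (Iio_mem_nhds hwv)
  exact Filter.mem_of_superset h fun x hx => ⟨hx.1.1, le_of_lt hx.2⟩

/-! ### Growth of the kernel at `w = 1` -/

/-- Contiguity relation raising `a'`. It comes from `(a')_n = (a' + 1)_n - n (a' + 1)_{n - 1}`
and a summation by parts in `n`. -/
theorem kernelSeries_contiguous (a a' b b' : ℂ) {c : ℂ} (hc : 0 < c.re) {w : ℝ} (h0 : 0 ≤ w)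
    (h1 : w < 1) :
    kernelSeries a a' b b' c w = (1 - w) * kernelSeries a (a' + 1) b b' c w +
      w * (b' / c) * kernelSeries a (a' + 1) b (b' + 1) (c + 1) w := by
  have hc1 : 0 < (c + 1).re := by simp; linarith
  have hc0 : c ≠ 0 := ne_zero_of_re_pos hc
  set f := fun k : ℕ × ℕ => kernelCoeff a a' b b' c k * (w : ℂ) ^ (k.1 + k.2)
  set g := fun k : ℕ × ℕ => kernelCoeff a (a' + 1) b b' c k * (w : ℂ) ^ (k.1 + k.2) with hg
  set g' := fun k : ℕ × ℕ =>
    kernelCoeff a (a' + 1) b (b' + 1) (c + 1) k * (w : ℂ) ^ (k.1 + k.2)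
  have sg : Summable g := summable_kernelCoeff _ _ _ _ hc h0 h1
  have sg' : Summable g' := summable_kernelCoeff _ _ _ _ hc1 h0 h1
  -- `h` carries the shifted part `n (a' + 1)_{n - 1}`, re-indexed by `n - 1`
  set h := fun k : ℕ × ℕ => w * g k - w * (b' / c) * g' k with hh
  have sh : Summable h := (sg.mul_left _).sub (sg'.mul_left _)
  set i : ℕ × ℕ → ℕ × ℕ := fun k => (k.1, k.2 + 1) with hi
  have hinj : Function.Injective i := by
    rintro ⟨m, n⟩ ⟨m', n'⟩ h; simp [hi] at h; simp [h]
  have hsupp : Function.support (fun k => g k - f k) ⊆ Set.range i := by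
    rintro ⟨m, n⟩ hk
    rcases n with _ | n
    · exfalso; apply hk; simp [f, hg, kernelCoeff, poch_zero]
    · exact ⟨(m, n), rfl⟩
  have hcomp : ∀ k, g (i k) - f (i k) = h k := by
    rintro ⟨m, n⟩
    simp only [f, g, g', hh, hi, kernelCoeff]
    have hcmn : c + ((m + n : ℕ) : ℂ) ≠ 0 :=
      ne_zero_of_re_pos (by simp; positivity)
    have e1 : poch (c + 1) (m + n) = poch c (m + n) * (c + ((m + n : ℕ) : ℂ)) / c := by
      rw [← poch_succ, poch_succ_left]; field_simp
    have e2 : poch (a' + 1) (n + 1) = poch (a' + 1) n * (a' + 1 + n) := poch_succ _ _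
    have e3 : poch a' (n + 1) = a' * poch (a' + 1) n := poch_succ_left _ _
    have hp := poch_ne_zero hc (m + n)
    rw [← add_assoc m n 1, e2, e3, poch_succ c, poch_succ (c - b' + m),
      show c + 1 - (b' + 1) + (m : ℂ) = c - b' + m by ring, e1, Nat.factorial_succ]
    have hm : (m.factorial : ℂ) ≠ 0 := by exact_mod_cast m.factorial_ne_zero
    have hn : (n.factorial : ℂ) ≠ 0 := by exact_mod_cast n.factorial_ne_zero
    have hn1 : (n : ℂ) + 1 ≠ 0 := by exact_mod_cast n.succ_ne_zero
    push_cast at hcmn ⊢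
    field_simp
    ring
  have key : ∑' k, (g k - f k) = ∑' k, h k := by
    rw [← hinj.tsum_eq hsupp]; exact tsum_congr hcomp
  have sf : Summable f := summable_kernelCoeff _ _ _ _ hc h0 h1
  rw [sg.tsum_sub sf, (sg.mul_left _).tsum_sub (sg'.mul_left _), tsum_mul_left,
    tsum_mul_left] at key
  show ∑' k, f k = (1 - w) * ∑' k, g k + w * (b' / c) * ∑' k, g' k
  linear_combination -key

/-- The order of growth of the kernel as `w → 1`. For `Re a' ≥ 1` it is read off from the absolute
values of the terms; for smaller `Re a'` these are too large because of cancellation, and the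
contiguity relation reduces to the first case. -/
theorem exists_norm_kernelSeries_le (K : ℕ) : ∀ {a a' b b' c : ℂ}, 0 < c.re → 1 - (K : ℝ) ≤ a'.re →
    ∀ {κ : ℝ}, 0 < κ → a'.re - b'.re < κ → a.re + a'.re + b.re - c.re < κ →
    ∃ C : ℝ, 0 ≤ C ∧ ∀ w : ℝ, 0 ≤ w → w < 1 → ‖kernelSeries a a' b b' c w‖ ≤ C * (1 - w) ^ (-κ) := by
  induction K with
  | zero =>
    intro a a' b b' c hc ha κ hκ hκ1 hκ2
    obtain ⟨S, hS, hS0, H⟩ := exists_summable_bound_kernelCoeff hc le_rfl (by simpa using ha) hκ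
      hκ1 hκ2
    refine ⟨∑' k, S k, tsum_nonneg hS0, fun w h0 h1 => ?_⟩
    rw [mul_comm, ← tsum_mul_left]
    refine tsum_of_norm_bounded (hS.mul_left _).hasSum fun k => ?_
    simpa [abs_of_nonneg h0] using H k w h0 h1
  | succ K ih =>
    intro a a' b b' c hc ha κ hκ hκ1 hκ2
    push_cast at ha
    have hc1 : 0 < (c + 1).re := by simp; linarith
    -- The first term of the contiguity relation may grow one order faster, because of its factor
    -- `1 - w`; in the second term the shifts of `a'`, `b'` and `c` leave the order unchanged.
    obtain ⟨C₁, hC₁, H₁⟩ := ih (a := a) (a' := a' + 1) (b := b) (b' := b') hc (by simp; linarith)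
      (κ := κ + 1) (by linarith) (by simp; linarith) (by simp; linarith)
    obtain ⟨C₂, hC₂, H₂⟩ := ih (a := a) (a' := a' + 1) (b := b) (b' := b' + 1) hc1
      (by simp; linarith) (κ := κ) hκ (by simp; linarith) (by simp; linarith)
    refine ⟨C₁ + ‖b' / c‖ * C₂, by positivity, fun w h0 h1 => ?_⟩
    have hu : 0 < 1 - w := by linarith
    have e1 : ‖(1 - w : ℂ)‖ = 1 - w := by
      rw [← Complex.ofReal_one, ← Complex.ofReal_sub, Complex.norm_real, Real.norm_of_nonneg hu.le]
    have e2 : ‖(w : ℂ)‖ = w := by rw [Complex.norm_real, Real.norm_of_nonneg h0]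
    rw [kernelSeries_contiguous a a' b b' hc h0 h1]
    refine (norm_add_le _ _).trans ?_
    rw [norm_mul, norm_mul, norm_mul, e1, e2, add_mul]
    refine add_le_add ?_ ?_
    · have : (1 - w) * (1 - w) ^ (-(κ + 1)) = (1 - w) ^ (-κ) := by
        rw [← Real.rpow_one_add' hu.le (by linarith)]; congr 1; ring
      calc _ ≤ (1 - w) * (C₁ * (1 - w) ^ (-(κ + 1))) := by gcongr; exact H₁ w h0 h1
        _ = _ := by rw [← this]; ring
    · calc _ ≤ 1 * ‖b' / c‖ * (C₂ * (1 - w) ^ (-κ)) := by gcongr; exact H₂ w h0 h1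
        _ = _ := by ring

/-! ### Gauss's summation theorem -/

theorem hasSum_poch_div_factorial (a : ℂ) {z : ℂ} (hz : ‖z‖ < 1) :
    HasSum (fun n : ℕ => poch a n / (n.factorial : ℂ) * z ^ n) ((1 - z) ^ (-a)) := by
  have h := (Complex.one_div_one_sub_cpow_hasFPowerSeriesOnBall_zero a).hasSum (y := z)
    (by simpa [enorm_eq_nnnorm, ← NNReal.coe_lt_one] using hz)
  rw [zero_add, one_div, ← Complex.cpow_neg] at h
  convert! h using 2 with n
  rw [FormalMultilinearSeries.ofScalars_apply_eq, ← Ring.multichoose_eq, smul_eq_mul]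
  congr 1
  have h2 := Ring.factorial_nsmul_multichoose_eq_ascPochhammer a n
  rw [Polynomial.ascPochhammer_smeval_eq_eval, nsmul_eq_mul] at h2
  rw [poch, ← h2, mul_div_cancel_left₀]
  exact_mod_cast n.factorial_ne_zero

theorem exists_bound_poch_div_factorial (a : ℂ) :
    ∃ κ : ℝ, 0 < κ ∧ ∃ S : ℕ → ℝ, Summable S ∧ ∀ n, ∀ t : ℝ, 0 ≤ t → t < 1 →
      ‖poch a n / (n.factorial : ℂ)‖ * t ^ n ≤ (1 - t) ^ (-κ) * S n := by
  obtain ⟨κ, hκ, S, hS, -, H⟩ :=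
    exists_crude_bound_kernelCoeff 0 a 0 0 (show 0 < (1 : ℂ).re by simp)
  refine ⟨κ, hκ, fun n => S (0, n), hS.comp_injective (Prod.mk_right_injective 0),
    fun n t h0 h1 => ?_⟩
  have := H (0, n) t h0 h1
  have hp := poch_ne_zero (show 0 < (1 : ℂ).re by simp) n
  have e : kernelCoeff 0 a 0 0 1 (0, n) = poch a n / (n.factorial : ℂ) := by
    have hn : (n.factorial : ℂ) ≠ 0 := by exact_mod_cast n.factorial_ne_zero
    simp [kernelCoeff, poch_zero]
    field_simp
  rwa [e, zero_add] at this

/-- Termwise integration of a series dominated by a summable family times one integrable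
function. -/
theorem hasSum_integral_of_norm_le_mul {ι : Type*} [Countable ι] {μ : Measure ℝ}
    {F : ι → ℝ → ℂ} {f : ℝ → ℂ} {φ : ℝ → ℝ} {S : ι → ℝ} (hF : ∀ i, AEStronglyMeasurable (F i) μ)
    (hS : Summable S) (hφ : Integrable φ μ) (hle : ∀ i, ∀ᵐ t ∂μ, ‖F i t‖ ≤ S i * φ t)
    (hf : ∀ᵐ t ∂μ, HasSum (fun i => F i t) (f t)) :
    HasSum (fun i => ∫ t, F i t ∂μ) (∫ t, f t ∂μ) := by
  refine hasSum_integral_of_dominated_convergence (fun i t => S i * φ t) hF hle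
    (Filter.Eventually.of_forall fun t => hS.mul_right _) ?_ hf
  simp_rw [tsum_mul_right]
  exact hφ.const_mul _

theorem integrableOn_beta {u v : ℂ} (hu : 0 < u.re) (hv : 0 < v.re) :
    IntegrableOn (fun t : ℝ => (t : ℂ) ^ (u - 1) * ((1 - t : ℝ) : ℂ) ^ (v - 1)) (Ioo 0 1) := by
  have h := Complex.betaIntegral_convergent hu hv
  rw [intervalIntegrable_iff_integrableOn_Ioo_of_le zero_le_one] at h
  simpa using h

theorem integral_beta {u v : ℂ} (hu : 0 < u.re) (hv : 0 < v.re) :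
    ∫ t in Ioo (0 : ℝ) 1, (t : ℂ) ^ (u - 1) * ((1 - t : ℝ) : ℂ) ^ (v - 1) =
      Complex.Gamma u * Complex.Gamma v * (Complex.Gamma (u + v))⁻¹ := by
  have h := Complex.Gamma_mul_Gamma_eq_betaIntegral hu hv
  have hne : Complex.Gamma (u + v) ≠ 0 :=
    Complex.Gamma_ne_zero_of_re_pos (by simp; linarith)
  rw [h, Complex.betaIntegral, intervalIntegral.integral_of_le zero_le_one,
    integral_Ioc_eq_integral_Ioo]
  field_simp
  simp

/-- Gauss's theorem in the case in which Euler's beta integral applies. -/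
theorem hasSum_gauss_of_re_pos (a : ℂ) : ∃ R : ℝ, ∀ b C : ℂ, 0 < b.re → R < (C - b).re →
    HasSum (fun n : ℕ => poch a n * poch b n / (n.factorial : ℂ) * (Complex.Gamma (C + n))⁻¹)
      (Complex.Gamma (C - a - b) * (Complex.Gamma (C - a))⁻¹ * (Complex.Gamma (C - b))⁻¹) := by
  obtain ⟨κ, hκ, S, hS, H⟩ := exists_bound_poch_div_factorial a
  refine ⟨max κ a.re, fun b C hb hC => ?_⟩
  have hC1 : 0 < (C - b - κ).re := by
    have := le_max_left κ a.re
    rw [Complex.sub_re, Complex.ofReal_re]; linarith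
  have hC2 : 0 < (C - a - b).re := by
    have := le_max_right κ a.re
    simp only [Complex.sub_re] at hC ⊢; linarith
  have hC3 : 0 < (C - b).re := by
    simp only [Complex.sub_re, Complex.ofReal_re] at hC1 ⊢; linarith
  have hterm : ∀ (n : ℕ), ∀ t ∈ Ioo (0 : ℝ) 1, poch a n / (n.factorial : ℂ) * (t : ℂ) ^ n *
      ((t : ℂ) ^ (b - 1) * ((1 - t : ℝ) : ℂ) ^ (C - b - 1)) =
      poch a n / (n.factorial : ℂ) *
        ((t : ℂ) ^ (b + n - 1) * ((1 - t : ℝ) : ℂ) ^ (C - b - 1)) := by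
    intro n t ht
    have ht0 : (t : ℂ) ≠ 0 := by exact_mod_cast ht.1.ne'
    rw [show b + n - 1 = b - 1 + n by ring, Complex.cpow_add _ _ ht0, Complex.cpow_natCast]
    ring
  have hbn : ∀ n : ℕ, 0 < (b + n).re := fun n => by simp; positivity
  have main := hasSum_integral_of_norm_le_mul (μ := volume.restrict (Ioo 0 1)) (S := S)
    (F := fun n t => poch a n / (n.factorial : ℂ) * (t : ℂ) ^ n *
      ((t : ℂ) ^ (b - 1) * ((1 - t : ℝ) : ℂ) ^ (C - b - 1)))
    (f := fun t => (t : ℂ) ^ (b - 1) * ((1 - t : ℝ) : ℂ) ^ (C - a - b - 1))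
    (φ := fun t : ℝ => ‖(t : ℂ) ^ (b - 1) * ((1 - t : ℝ) : ℂ) ^ (C - b - κ - 1)‖)
    (fun n => (by fun_prop : AEStronglyMeasurable
      (fun t : ℝ => poch a n / (n.factorial : ℂ) * (t : ℂ) ^ n) _).mul
        (integrableOn_beta hb hC3).aestronglyMeasurable)
    hS (integrableOn_beta hb hC1).norm
    (fun n => by
      filter_upwards [ae_restrict_mem measurableSet_Ioo] with t ht
      have h1t : 0 < 1 - t := by linarith [ht.2]
      have := H n t ht.1.le ht.2
      rw [norm_mul, norm_mul, norm_mul, norm_mul, norm_pow, Complex.norm_real,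
        Real.norm_of_nonneg ht.1.le, Complex.norm_cpow_eq_rpow_re_of_pos h1t,
        Complex.norm_cpow_eq_rpow_re_of_pos h1t]
      have e : (1 - t) ^ (C - b - κ - 1).re = (1 - t) ^ (-κ) * (1 - t) ^ (C - b - 1).re := by
        rw [← Real.rpow_add h1t]; congr 1; simp; ring
      rw [e]
      calc _ ≤ (1 - t) ^ (-κ) * S n * (‖(t : ℂ) ^ (b - 1)‖ * (1 - t) ^ (C - b - 1).re) := by
            gcongr
        _ = _ := by ring)
    (by
      filter_upwards [ae_restrict_mem measurableSet_Ioo] with t ht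
      have h1t : ((1 - t : ℝ) : ℂ) ≠ 0 := by exact_mod_cast (sub_pos.2 ht.2).ne'
      have h := (hasSum_poch_div_factorial a (z := (t : ℂ))
        (by rw [Complex.norm_real, Real.norm_of_nonneg ht.1.le]; exact ht.2)).mul_right
          ((t : ℂ) ^ (b - 1) * ((1 - t : ℝ) : ℂ) ^ (C - b - 1))
      convert! h using 1
      rw [show C - a - b - 1 = -a + (C - b - 1) by ring, Complex.cpow_add _ _ h1t]
      push_cast; ring)
  have e1 : ∀ n : ℕ, ∫ t in Ioo (0 : ℝ) 1, poch a n / (n.factorial : ℂ) * (t : ℂ) ^ n *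
      ((t : ℂ) ^ (b - 1) * ((1 - t : ℝ) : ℂ) ^ (C - b - 1)) =
      poch a n * poch b n / (n.factorial : ℂ) * (Complex.Gamma (C + n))⁻¹ *
        (Complex.Gamma b * Complex.Gamma (C - b)) := by
    intro n
    rw [setIntegral_congr_fun measurableSet_Ioo (hterm n), integral_const_mul,
      integral_beta (hbn n) hC3, Gamma_add_nat hb, show b + n + (C - b) = C + n by ring]
    ring
  simp_rw [e1] at main
  rw [integral_beta hb hC2, show b + (C - a - b) = C - a by ring] at main
  have g1 := Complex.Gamma_ne_zero_of_re_pos hb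
  have g2 := Complex.Gamma_ne_zero_of_re_pos hC3
  have := main.mul_right (Complex.Gamma b * Complex.Gamma (C - b))⁻¹
  convert! this using 1
  · ext n; field_simp
  · field_simp

/-- Gauss's summation theorem, divided by `Γ(C)` so that it makes sense when `C` is a pole of `Γ`,
for `Re (C - b)` large. The bound does not depend on `b` in a half-plane `-M < Re b`. The induction
on `M` uses `(b)_n = (b + 1)_n - n (b + 1)_{n - 1}`, which expresses the sum for `(a, b, C)` by those
for `(a, b + 1, C)` and `(a + 1, b + 1, C + 1)`. -/
theorem hasSum_gauss (M : ℕ) : ∀ a : ℂ, ∃ R : ℝ, ∀ b C : ℂ, -(M : ℝ) < b.re → R < (C - b).re →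
    HasSum (fun n : ℕ => poch a n * poch b n / (n.factorial : ℂ) * (Complex.Gamma (C + n))⁻¹)
      (Complex.Gamma (C - a - b) * (Complex.Gamma (C - a))⁻¹ * (Complex.Gamma (C - b))⁻¹) := by
  induction M with
  | zero => simpa using hasSum_gauss_of_re_pos
  | succ M ih =>
    intro a
    obtain ⟨R₁, H₁⟩ := ih a
    obtain ⟨R₂, H₂⟩ := ih (a + 1)
    refine ⟨max (R₁ + 1) (max R₂ (a.re + 1)), fun b C hb hC => ?_⟩
    push_cast at hb
    rw [max_lt_iff, max_lt_iff] at hC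
    obtain ⟨hC1, hC2, hC3⟩ := hC
    simp only [Complex.sub_re] at hC1 hC2 hC3
    have s₁ := H₁ (b + 1) C (by simp; linarith) (by simp; linarith)
    have s₂ := H₂ (b + 1) (C + 1) (by simp; linarith) (by simp; linarith)
    have s₃ : HasSum (fun n : ℕ => (n : ℂ) * (poch a n * poch (b + 1) (n - 1) /
        (n.factorial : ℂ) * (Complex.Gamma (C + n))⁻¹))
        (a * (Complex.Gamma (C + 1 - (a + 1) - (b + 1)) * (Complex.Gamma (C + 1 - (a + 1)))⁻¹ *
          (Complex.Gamma (C + 1 - (b + 1)))⁻¹)) := by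
      rw [← hasSum_nat_add_iff' 1]
      simp only [Finset.range_one, Finset.sum_singleton, Nat.cast_zero, zero_mul, sub_zero]
      convert! s₂.mul_left a using 1
      ext n
      have hn1 : (n : ℂ) + 1 ≠ 0 := by exact_mod_cast n.succ_ne_zero
      rw [poch_succ_left, Nat.add_sub_cancel, Nat.factorial_succ,
        show C + ((n + 1 : ℕ) : ℂ) = C + 1 + n by push_cast; ring]
      push_cast
      have hn : (n.factorial : ℂ) ≠ 0 := by exact_mod_cast n.factorial_ne_zero
      field_simp
    have key := s₁.sub s₃
    convert! key using 1
    · ext n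
      rcases n with _ | n
      · simp [poch_zero]
      · rw [poch_succ (b + 1), poch_succ_left b, Nat.add_sub_cancel]; push_cast; ring
    · have hne : C - a - b - 1 ≠ 0 := ne_zero_of_re_pos (by simp; linarith)
      have e1 : Complex.Gamma (C - a - b) = (C - a - b - 1) * Complex.Gamma (C - a - b - 1) := by
        rw [← Complex.Gamma_add_one _ hne]; ring_nf
      have e2 : (Complex.Gamma (C - (b + 1)))⁻¹ = (C - b - 1) * (Complex.Gamma (C - b))⁻¹ := by
        rw [Complex.one_div_Gamma_eq_self_mul_one_div_Gamma_add_one]; ring_nf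
      rw [e1, e2, show C + 1 - (a + 1) - (b + 1) = C - a - b - 1 by ring,
        show C - a - (b + 1) = C - a - b - 1 by ring, show C + 1 - (a + 1) = C - a by ring,
        show C + 1 - (b + 1) = C - b by ring]
      ring

/-! ### Pfaff's transformation and the function `F₃` -/

theorem ordinaryHypergeometric_eq_tsum_poch (a b c z : ℂ) :
    ordinaryHypergeometric a b c z =
      ∑' n : ℕ, poch a n * poch b n / (poch c n * (n.factorial : ℂ)) * z ^ n := by
  rw [ordinaryHypergeometric_eq_tsum]
  refine tsum_congr fun n => ?_
  rw [smul_eq_mul]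
  simp only [poch]
  rw [div_eq_mul_inv, mul_inv]
  ring

/-- The Chu–Vandermonde identity. -/
theorem sum_antidiagonal_choose_mul_poch (N : ℕ) : ∀ (b : ℂ) {c : ℂ}, 0 < c.re →
    ∑ ij ∈ Finset.HasAntidiagonal.antidiagonal N, (N.choose ij.1 : ℂ) *
      ((-1) ^ ij.1 * (poch b ij.1 / poch c ij.1)) = poch (c - b) N / poch c N := by
  induction N with
  | zero => intro b c _; simp [poch_zero]
  | succ N ih =>
    intro b c hc
    have hc1 : 0 < (c + 1).re := by simp; linarith
    have hc0 : c ≠ 0 := ne_zero_of_re_pos hc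
    rw [Finset.sum_antidiagonal_choose_succ_mul
      (fun i _ => (-1 : ℂ) ^ i * (poch b i / poch c i)), ih b hc]
    have e : ∑ ij ∈ Finset.HasAntidiagonal.antidiagonal N, (N.choose ij.2 : ℂ) *
        ((-1) ^ (ij.1 + 1) * (poch b (ij.1 + 1) / poch c (ij.1 + 1))) =
        -(b / c) * ∑ ij ∈ Finset.HasAntidiagonal.antidiagonal N, (N.choose ij.1 : ℂ) *
          ((-1) ^ ij.1 * (poch (b + 1) ij.1 / poch (c + 1) ij.1)) := by
      rw [Finset.mul_sum]
      refine Finset.sum_congr rfl fun ij hij => ?_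
      rw [Finset.HasAntidiagonal.mem_antidiagonal] at hij
      rw [Nat.choose_symm_of_eq_add hij.symm, poch_succ_left, poch_succ_left, pow_succ]
      have := poch_ne_zero hc1 ij.1
      field_simp
    rw [e, ih (b + 1) hc1, show c + 1 - (b + 1) = c - b by ring, poch_succ (c - b), poch_succ_left c]
    have h1 := poch_ne_zero hc1 N
    have h2 := poch_ne_zero hc N
    have h3 : c * poch (c + 1) N = poch c N * (c + N) := by rw [← poch_succ_left, poch_succ]
    field_simp
    linear_combination (poch (c - b) N) * h3

theorem exists_rpow_mul_pow_le_pow (R : ℝ) {w v : ℝ} (h0 : 0 ≤ w) (hwv : w < v) :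
    ∃ D : ℝ, 0 < D ∧ ∀ N : ℕ, ((N : ℝ) + 1) ^ R * w ^ N ≤ D * v ^ N := by
  have hv : 0 < v := h0.trans_lt hwv
  have hlt : w / v < 1 := (div_lt_one hv).2 hwv
  obtain ⟨D, hD, H⟩ := exists_rpow_mul_pow_le (κ := |R| + 1) (by positivity)
  refine ⟨D * (1 - w / v) ^ (-(|R| + 1)),
    mul_pos hD (Real.rpow_pos_of_pos (by linarith) _), fun N => ?_⟩
  have h1 := H N (w / v) (by positivity) hlt
  have h2 : ((N : ℝ) + 1) ^ R ≤ ((N : ℝ) + 1) ^ (|R| + 1) :=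
    Real.rpow_le_rpow_of_exponent_le (by simp) (by linarith [le_abs_self R])
  have h3 : w ^ N = (w / v) ^ N * v ^ N := by rw [← mul_pow, div_mul_cancel₀ _ hv.ne']
  rw [h3, ← mul_assoc]
  refine mul_le_mul_of_nonneg_right (le_trans ?_ h1) (by positivity)
  gcongr

theorem summable_rpow_mul_pow (R : ℝ) {w : ℝ} (h0 : 0 ≤ w) (h1 : w < 1) :
    Summable fun n : ℕ => ((n : ℝ) + 1) ^ R * w ^ n := by
  obtain ⟨v, hwv, hv⟩ := exists_between h1
  obtain ⟨D, hD, H⟩ := exists_rpow_mul_pow_le_pow R h0 hwv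
  exact Summable.of_nonneg_of_le (fun n => by positivity) H
    ((summable_geometric_of_lt_one (h0.trans hwv.le) hv).mul_left D)

theorem summable_choose_mul_pow {v : ℝ} (h0 : 0 ≤ v) (h1 : v < 1 / 2) :
    Summable fun k : ℕ × ℕ => ((k.1 + k.2).choose k.1 : ℝ) * v ^ (k.1 + k.2) := by
  rw [← Finset.HasAntidiagonal.sigmaAntidiagonalEquivProd.summable_iff, summable_sigma_of_nonneg
    (fun _ => by simp only [Function.comp]; positivity)]
  refine ⟨fun N => Summable.of_finite, ?_⟩
  have : Summable fun N : ℕ => (2 * v) ^ N :=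
    summable_geometric_of_lt_one (by positivity) (by linarith)
  refine this.congr fun N => ?_
  rw [tsum_fintype, Finset.univ_eq_attach]
  simp only [Function.comp, Finset.HasAntidiagonal.sigmaAntidiagonalEquivProd_apply]
  rw [Finset.sum_attach (Finset.HasAntidiagonal.antidiagonal N)
    (fun k => ((k.1 + k.2).choose k.1 : ℝ) * v ^ (k.1 + k.2))]
  have e : ∀ k ∈ Finset.HasAntidiagonal.antidiagonal N,
      ((k.1 + k.2).choose k.1 : ℝ) * v ^ (k.1 + k.2) = (N.choose k.1 : ℝ) * v ^ N := by
    intro k hk; rw [Finset.HasAntidiagonal.mem_antidiagonal.1 hk]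
  rw [Finset.sum_congr rfl e, ← Finset.sum_mul, mul_pow]
  congr 1
  have := Nat.sum_range_choose N
  rw [Finset.Nat.sum_antidiagonal_eq_sum_range_succ_mk]
  exact_mod_cast this.symm

/-- The double series behind Pfaff's transformation: it is summed by rows to the left-hand side and
by diagonals to the right-hand side. -/
theorem summable_pfaff (a b : ℂ) {c : ℂ} (hc : 0 < c.re) {w : ℝ} (h0 : 0 ≤ w) (h1 : w < 1 / 2) :
    Summable fun k : ℕ × ℕ => poch a (k.1 + k.2) * poch b k.1 /
      (poch c k.1 * (k.1.factorial : ℂ) * (k.2.factorial : ℂ)) * (-1) ^ k.1 *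
        (w : ℂ) ^ (k.1 + k.2) := by
  obtain ⟨C₁, p₁, H₁⟩ := exists_norm_poch_le a
  obtain ⟨C₂, p₂, H₂⟩ := exists_norm_poch_le b
  obtain ⟨C₃, p₃, H₃⟩ := exists_factorial_div_norm_poch_le hc
  obtain ⟨v, hwv, hv⟩ := exists_between h1
  set r := a.re - 1
  set s := b.re - 1 + (1 - c.re) with hs
  obtain ⟨D, hD, HD⟩ := exists_rpow_mul_pow_le_pow (r + |s|) h0 hwv
  refine Summable.of_norm_bounded
    ((summable_choose_mul_pow (h0.trans hwv.le) hv).mul_left (C₁ * C₂ * C₃ * D)) ?_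
  rintro ⟨m, n⟩
  have hf : ∀ k : ℕ, (0 : ℝ) < k.factorial := fun k => by exact_mod_cast k.factorial_pos
  have hm := (hf m).ne'
  have hn := (hf n).ne'
  have hp : ‖poch c m‖ ≠ 0 := norm_ne_zero_iff.2 (poch_ne_zero hc _)
  have hM : (0 : ℝ) < (m : ℝ) + 1 := by positivity
  have hT : (0 : ℝ) < ((m + n : ℕ) : ℝ) + 1 := by positivity
  have hch : ((m + n).choose m : ℝ) = (m + n).factorial / (m.factorial * n.factorial) := by
    rw [Nat.cast_add_choose]
  have b1 : ((m : ℝ) + 1) ^ s ≤ (((m + n : ℕ) : ℝ) + 1) ^ |s| :=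
    (Real.rpow_le_rpow_of_exponent_le (by simp) (le_abs_self s)).trans
      (Real.rpow_le_rpow hM.le (by simp) (abs_nonneg s))
  have e : ‖poch a (m + n) * poch b m / (poch c m * (m.factorial : ℂ) * (n.factorial : ℂ)) *
      (-1) ^ m * (w : ℂ) ^ (m + n)‖ = ‖poch a (m + n)‖ * ‖poch b m‖ *
        ((m.factorial : ℝ) / ‖poch c m‖) * (1 / (m.factorial * m.factorial * n.factorial)) *
          w ^ (m + n) := by
    simp only [norm_mul, norm_div, norm_pow, Complex.norm_natCast, norm_neg, norm_one, one_pow,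
      mul_one, Complex.norm_real, Real.norm_of_nonneg h0]
    field_simp
  rw [e]
  calc _ ≤ (C₁ * (m + n).factorial * (((m + n : ℕ) : ℝ) + 1) ^ r) *
        (C₂ * m.factorial * ((m : ℝ) + 1) ^ (b.re - 1)) * (C₃ * ((m : ℝ) + 1) ^ (1 - c.re)) *
        (1 / (m.factorial * m.factorial * n.factorial)) * w ^ (m + n) := by
        gcongr
        exacts [H₁ _, H₂ m, H₃ m]
    _ = C₁ * C₂ * C₃ * (m + n).choose m * ((((m + n : ℕ) : ℝ) + 1) ^ r * ((m : ℝ) + 1) ^ s) *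
        w ^ (m + n) := by
        rw [hch, hs, Real.rpow_add hM]; field_simp
    _ ≤ C₁ * C₂ * C₃ * (m + n).choose m *
        ((((m + n : ℕ) : ℝ) + 1) ^ r * (((m + n : ℕ) : ℝ) + 1) ^ |s|) * w ^ (m + n) := by gcongr
    _ = C₁ * C₂ * C₃ * (m + n).choose m *
        ((((m + n : ℕ) : ℝ) + 1) ^ (r + |s|) * w ^ (m + n)) := by rw [Real.rpow_add hT]; ring
    _ ≤ C₁ * C₂ * C₃ * (m + n).choose m * (D * v ^ (m + n)) :=
        mul_le_mul_of_nonneg_left (HD _) (by positivity)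
    _ = _ := by ring

/-- Pfaff's transformation on `[0, 1/2)`, where all the expansions involved converge absolutely. -/
theorem pfaff (a b : ℂ) {c : ℂ} (hc : 0 < c.re) {w : ℝ} (h0 : 0 ≤ w) (h1 : w < 1 / 2) :
    ((1 - w : ℝ) : ℂ) ^ (-a) * ordinaryHypergeometric a b c (-(w / (1 - w) : ℂ)) =
      ordinaryHypergeometric a (c - b) c (w : ℂ) := by
  have hF := (summable_pfaff a b hc h0 h1).hasSum
  set S := ∑' k : ℕ × ℕ, poch a (k.1 + k.2) * poch b k.1 /
      (poch c k.1 * (k.1.factorial : ℂ) * (k.2.factorial : ℂ)) * (-1) ^ k.1 *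
        (w : ℂ) ^ (k.1 + k.2)
  have hu : ((1 - w : ℝ) : ℂ) ≠ 0 := by
    have : 1 - w ≠ 0 := by linarith
    exact_mod_cast this
  have hu' : (1 - (w : ℂ)) ≠ 0 := by simpa using hu
  have hfac : ∀ n : ℕ, (n.factorial : ℂ) ≠ 0 := fun n => by exact_mod_cast n.factorial_ne_zero
  have rows : HasSum (fun m : ℕ => poch a m * poch b m / (poch c m * (m.factorial : ℂ)) *
      (-1) ^ m * (w : ℂ) ^ m * ((1 - w : ℝ) : ℂ) ^ (-(a + m))) S := by
    refine hF.prod_fiberwise fun m => ?_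
    have h := (hasSum_poch_div_factorial (a + m) (z := (w : ℂ))
      (by rw [Complex.norm_real, Real.norm_of_nonneg h0]; linarith)).mul_left
        (poch a m * poch b m / (poch c m * (m.factorial : ℂ)) * (-1) ^ m * (w : ℂ) ^ m)
    convert! h using 1
    · ext n
      rw [poch_add, pow_add]
      have := poch_ne_zero hc m
      field_simp [hfac m, hfac n]
    · push_cast; rfl
  have diag : HasSum (fun N : ℕ => poch a N * poch (c - b) N / (poch c N * (N.factorial : ℂ)) *
      (w : ℂ) ^ N) S := by
    rw [← Finset.HasAntidiagonal.sigmaAntidiagonalEquivProd.hasSum_iff] at hF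
    have h := hF.sigma (fun N => hasSum_fintype _)
    convert! h using 1
    ext N
    rw [Finset.univ_eq_attach]
    simp only [Function.comp, Finset.HasAntidiagonal.sigmaAntidiagonalEquivProd_apply]
    rw [Finset.sum_attach (Finset.HasAntidiagonal.antidiagonal N) (fun k =>
      poch a (k.1 + k.2) * poch b k.1 / (poch c k.1 * (k.1.factorial : ℂ) * (k.2.factorial : ℂ)) * (-1) ^ k.1 *
        (w : ℂ) ^ (k.1 + k.2))]
    have e : ∀ k ∈ Finset.HasAntidiagonal.antidiagonal N, poch a (k.1 + k.2) * poch b k.1 /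
      (poch c k.1 * (k.1.factorial : ℂ) * (k.2.factorial : ℂ)) * (-1) ^ k.1 *
        (w : ℂ) ^ (k.1 + k.2) = poch a N / (N.factorial : ℂ) * (w : ℂ) ^ N *
          ((N.choose k.1 : ℂ) * ((-1) ^ k.1 * (poch b k.1 / poch c k.1))) := by
      intro k hk
      rw [Finset.HasAntidiagonal.mem_antidiagonal] at hk
      subst hk
      rw [Nat.cast_add_choose]
      have := poch_ne_zero hc k.1
      field_simp [hfac k.1, hfac k.2, hfac (k.1 + k.2)]
    rw [Finset.sum_congr rfl e, ← Finset.mul_sum, sum_antidiagonal_choose_mul_poch N b hc]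
    have := poch_ne_zero hc N
    field_simp [hfac N]
  rw [ordinaryHypergeometric_eq_tsum_poch, ordinaryHypergeometric_eq_tsum_poch, diag.tsum_eq,
    ← rows.tsum_eq, ← tsum_mul_left]
  refine tsum_congr fun m => ?_
  rw [neg_add, Complex.cpow_add _ _ hu, Complex.cpow_neg _ (m : ℂ), Complex.cpow_natCast, neg_pow,
    div_pow]
  push_cast
  field_simp

theorem kernelSeries_eq_tsum (a a' b b' : ℂ) {c : ℂ} (hc : 0 < c.re) {w : ℝ} (h0 : 0 ≤ w)
    (h1 : w < 1) :
    kernelSeries a a' b b' c w = ∑' m : ℕ, poch a m * poch b m / (poch c m * (m.factorial : ℂ)) *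
      (w : ℂ) ^ m * ordinaryHypergeometric a' (c + m - b') (c + m) (w : ℂ) := by
  rw [kernelSeries, (summable_kernelCoeff a a' b b' hc h0 h1).tsum_prod]
  refine tsum_congr fun m => ?_
  rw [ordinaryHypergeometric_eq_tsum_poch, ← tsum_mul_left]
  refine tsum_congr fun n => ?_
  have hcm : 0 < (c + m).re := by simp; positivity
  have h1 := poch_ne_zero hc m
  have h2 := poch_ne_zero hcm n
  have hm : (m.factorial : ℂ) ≠ 0 := by exact_mod_cast m.factorial_ne_zero
  have hn : (n.factorial : ℂ) ≠ 0 := by exact_mod_cast n.factorial_ne_zero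
  rw [kernelCoeff, pow_add, poch_add c, show c - b' + (m : ℂ) = c + m - b' by ring]
  field_simp

theorem summable_appellF3 (a a' b b' : ℂ) {c x y : ℂ} (hc : 0 < c.re) (hx : ‖x‖ < 1)
    (hy : ‖y‖ < 1) :
    Summable fun k : ℕ × ℕ => poch a k.1 * poch a' k.2 * poch b k.1 * poch b' k.2 /
      (poch c (k.1 + k.2) * (k.1.factorial : ℂ) * (k.2.factorial : ℂ)) * x ^ k.1 * y ^ k.2 := by
  obtain ⟨C₁, p₁, H₁⟩ := exists_norm_poch_le a
  obtain ⟨C₂, p₂, H₂⟩ := exists_norm_poch_le b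
  obtain ⟨C₃, p₃, H₃⟩ := exists_norm_poch_le a'
  obtain ⟨C₄, p₄, H₄⟩ := exists_norm_poch_le b'
  obtain ⟨C₅, p₅, H₅⟩ := exists_factorial_div_norm_poch_le hc
  have hs := ((summable_rpow_mul_pow (a.re - 1 + (b.re - 1) + |1 - c.re|) (norm_nonneg x)
    hx).mul_of_nonneg (summable_rpow_mul_pow (a'.re - 1 + (b'.re - 1) + |1 - c.re|)
      (norm_nonneg y) hy) (fun _ => by positivity) (fun _ => by positivity)).mul_left
        (C₁ * C₂ * C₃ * C₄ * C₅)
  refine Summable.of_norm_bounded hs ?_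
  rintro ⟨m, n⟩
  have hf : ∀ k : ℕ, (0 : ℝ) < k.factorial := fun k => by exact_mod_cast k.factorial_pos
  have hm := (hf m).ne'
  have hn := (hf n).ne'
  have hmn := (hf (m + n)).ne'
  have hp : ‖poch c (m + n)‖ ≠ 0 := norm_ne_zero_iff.2 (poch_ne_zero hc _)
  have hM : (0 : ℝ) < (m : ℝ) + 1 := by positivity
  have hN : (0 : ℝ) < (n : ℝ) + 1 := by positivity
  have b1 : (((m + n : ℕ) : ℝ) + 1) ^ (1 - c.re) ≤
      ((m : ℝ) + 1) ^ |1 - c.re| * ((n : ℝ) + 1) ^ |1 - c.re| := by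
    rw [← Real.mul_rpow hM.le hN.le]
    refine (Real.rpow_le_rpow_of_exponent_le (by simp; positivity) (le_abs_self _)).trans
      (Real.rpow_le_rpow (Nat.cast_add_one_pos _).le ?_ (abs_nonneg _))
    push_cast
    nlinarith [Nat.cast_nonneg (α := ℝ) m, Nat.cast_nonneg (α := ℝ) n,
      mul_nonneg (Nat.cast_nonneg (α := ℝ) m) (Nat.cast_nonneg (α := ℝ) n)]
  have b2 : (m.factorial : ℝ) * n.factorial / (m + n).factorial ≤ 1 := by
    rw [div_le_one (hf _)]
    exact_mod_cast Nat.le_of_dvd (Nat.factorial_pos _)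
      (Nat.factorial_mul_factorial_dvd_factorial_add m n)
  have e : ‖poch a m * poch a' n * poch b m * poch b' n /
      (poch c (m + n) * (m.factorial : ℂ) * (n.factorial : ℂ)) * x ^ m * y ^ n‖ =
      ‖poch a m‖ * ‖poch b m‖ * ‖poch a' n‖ * ‖poch b' n‖ *
        (((m + n).factorial : ℝ) / ‖poch c (m + n)‖) *
        (1 / ((m + n).factorial * m.factorial * n.factorial)) * ‖x‖ ^ m * ‖y‖ ^ n := by
    simp only [norm_mul, norm_div, norm_pow, Complex.norm_natCast]
    field_simp
  rw [e]
  calc _ ≤ (C₁ * m.factorial * ((m : ℝ) + 1) ^ (a.re - 1)) *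
        (C₂ * m.factorial * ((m : ℝ) + 1) ^ (b.re - 1)) *
        (C₃ * n.factorial * ((n : ℝ) + 1) ^ (a'.re - 1)) *
        (C₄ * n.factorial * ((n : ℝ) + 1) ^ (b'.re - 1)) *
        (C₅ * (((m : ℝ) + 1) ^ |1 - c.re| * ((n : ℝ) + 1) ^ |1 - c.re|)) *
        (1 / ((m + n).factorial * m.factorial * n.factorial)) * ‖x‖ ^ m * ‖y‖ ^ n := by
        gcongr
        exacts [H₁ m, H₂ m, H₃ n, H₄ n, (H₅ _).trans (mul_le_mul_of_nonneg_left b1 p₅.le)]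
    _ = (m.factorial * n.factorial / (m + n).factorial) * (C₁ * C₂ * C₃ * C₄ * C₅ *
        (((m : ℝ) + 1) ^ (a.re - 1 + (b.re - 1) + |1 - c.re|) * ‖x‖ ^ m *
          (((n : ℝ) + 1) ^ (a'.re - 1 + (b'.re - 1) + |1 - c.re|) * ‖y‖ ^ n))) := by
        rw [Real.rpow_add hM, Real.rpow_add hM, Real.rpow_add hN, Real.rpow_add hN]
        field_simp
    _ ≤ 1 * _ := by gcongr
    _ = _ := one_mul _

/-- On the range of integration, both branches of the definition of `F₃` are the same multiple of
the kernel series. -/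
theorem appellF3_eq_kernelSeries (a a' b b' : ℂ) {c : ℂ} (hc : 0 < c.re) {x t : ℝ} (hx : 0 < x)
    (ht : x < t) :
    appellF3 a a' b b' c ((1 - x / t : ℝ) : ℂ) ((1 - t / x : ℝ) : ℂ) =
      ((x / t : ℝ) : ℂ) ^ a' * kernelSeries a a' b b' c (1 - x / t) := by
  have ht0 : 0 < t := hx.trans ht
  have hu0 : 0 < x / t := by positivity
  have hu1 : x / t < 1 := (div_lt_one ht0).2 ht
  set w := 1 - x / t with hw
  have h0 : 0 ≤ w := by linarith
  have h1 : w < 1 := by linarith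
  have hxc : (x : ℂ) ≠ 0 := by exact_mod_cast hx.ne'
  have htc : (t : ℂ) ≠ 0 := by exact_mod_cast ht0.ne'
  rw [kernelSeries_eq_tsum a a' b b' hc h0 h1, appellF3]
  split_ifs with h
  · rw [(summable_appellF3 a a' b b' hc h.1 h.2).tsum_prod, ← tsum_mul_left]
    refine tsum_congr fun m => ?_
    have hcm : 0 < (c + m).re := by simp; positivity
    have hw2 : w < 1 / 2 := by
      have h2 := h.2
      rw [Complex.norm_real, Real.norm_eq_abs, abs_lt] at h2
      have h3 : t / x < 2 := by linarith [h2.1]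
      rw [div_lt_iff₀ hx] at h3
      have : 1 / 2 < x / t := by rw [lt_div_iff₀ ht0]; linarith
      linarith
    have hy : ((1 - t / x : ℝ) : ℂ) = -((w : ℂ) / (1 - (w : ℂ))) := by
      rw [hw]; push_cast
      rw [show (1 : ℂ) - (1 - x / t) = x / t by ring]
      field_simp
      ring
    have hp := pfaff a' b' hcm h0 hw2
    have hone : ((x / t : ℝ) : ℂ) ^ a' * ((1 - w : ℝ) : ℂ) ^ (-a') = 1 := by
      have hne : ((x / t : ℝ) : ℂ) ≠ 0 := by exact_mod_cast hu0.ne'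
      rw [hw, show 1 - (1 - x / t) = x / t by ring, ← Complex.cpow_add _ _ hne]
      simp
    rw [← hp, show ∀ A B D E : ℂ, A * (B * (D * E)) = A * D * (B * E) by intros; ring, hone,
      one_mul, hy, ordinaryHypergeometric_eq_tsum_poch, ← tsum_mul_left]
    refine tsum_congr fun n => ?_
    have g1 := poch_ne_zero hc m
    have g2 := poch_ne_zero hcm n
    have hm : (m.factorial : ℂ) ≠ 0 := by exact_mod_cast m.factorial_ne_zero
    have hn : (n.factorial : ℂ) ≠ 0 := by exact_mod_cast n.factorial_ne_zero
    rw [poch_add c]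
    field_simp
  · rw [← tsum_mul_left]
    refine tsum_congr fun m => ?_
    have e1 : ((1 - t / x : ℝ) : ℂ) / (((1 - t / x : ℝ) : ℂ) - 1) = (w : ℂ) := by
      have hxt : (x : ℂ) - t ≠ 0 := by
        have : x - t ≠ 0 := by linarith
        exact_mod_cast this
      rw [hw, show ((1 - t / x : ℝ) : ℂ) = (x - t) / x by push_cast; field_simp,
        show ((x : ℂ) - t) / x - 1 = -(t / x) by field_simp; ring]
      push_cast; field_simp; ring
    have e2 : (1 - ((1 - t / x : ℝ) : ℂ)) ^ (-a') = ((x / t : ℝ) : ℂ) ^ a' := by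
      rw [show (1 - ((1 - t / x : ℝ) : ℂ)) = ((x / t : ℝ) : ℂ)⁻¹ by push_cast; field_simp; ring,
        Complex.inv_cpow, Complex.cpow_neg, inv_inv]
      rw [Complex.arg_ofReal_of_nonneg hu0.le]
      exact Real.pi_pos.ne
    rw [gaussPfaff, e1, e2]
    ring

/-! ### The Mellin transform of the kernel -/

/-- The kernel of the operator as a function of `u = x / t`, extended by `0` to `u ≥ 1`. -/
noncomputable def msmKernel (a a' b b' c : ℂ) (u : ℝ) : ℂ :=
  open Classical in
  if u < 1 then ((1 - u : ℝ) : ℂ) ^ (c - 1) * kernelSeries a a' b b' c (1 - u) else 0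

theorem continuousOn_kernelSeries_one_sub (a a' b b' : ℂ) {c : ℂ} (hc : 0 < c.re) :
    ContinuousOn (fun u : ℝ => kernelSeries a a' b b' c (1 - u)) (Ioo 0 1) :=
  (continuousOn_kernelSeries a a' b b' hc).comp (by fun_prop)
    fun u hu => ⟨by linarith [hu.2], by linarith [hu.1]⟩

theorem mellin_msmKernel (a a' b b' c A : ℂ) : mellin (msmKernel a a' b b' c) A =
    ∫ u in Ioo (0 : ℝ) 1, (u : ℂ) ^ (A - 1) *
      (((1 - u : ℝ) : ℂ) ^ (c - 1) * kernelSeries a a' b b' c (1 - u)) := by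
  have h : (fun u : ℝ => (u : ℂ) ^ (A - 1) • msmKernel a a' b b' c u) = indicator (Iio 1)
      (fun u : ℝ => (u : ℂ) ^ (A - 1) *
        (((1 - u : ℝ) : ℂ) ^ (c - 1) * kernelSeries a a' b b' c (1 - u))) := by
    ext u
    by_cases hu : u < 1 <;> simp [msmKernel, hu]
  rw [mellin, h, setIntegral_indicator measurableSet_Iio, Ioi_inter_Iio]

theorem locallyIntegrableOn_msmKernel (a a' b b' : ℂ) {c : ℂ} (hc : 0 < c.re) :
    LocallyIntegrableOn (msmKernel a a' b b' c) (Ioi 0) := by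
  have main : ∀ v : ℝ, 0 < v → IntegrableOn (msmKernel a a' b b' c) (Ioi v) := by
    intro v hv
    have h : msmKernel a a' b b' c = indicator (Iio 1)
        (fun u : ℝ => ((1 - u : ℝ) : ℂ) ^ (c - 1) * kernelSeries a a' b b' c (1 - u)) := by
      ext u
      by_cases hu : u < 1 <;> simp [msmKernel, hu]
    rw [h, IntegrableOn, integrable_indicator_iff measurableSet_Iio, IntegrableOn,
      Measure.restrict_restrict measurableSet_Iio, Iio_inter_Ioi]
    obtain ⟨κ, hκ, S, hS, hS0, H⟩ := exists_crude_bound_kernelCoeff a a' b b' hc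
    have hsub : Ioo v 1 ⊆ Ioo 0 1 := Ioo_subset_Ioo_left hv.le
    have hint : IntegrableOn (fun u : ℝ => ((1 - u : ℝ) : ℂ) ^ (c - 1)) (Ioo v 1) := by
      have := integrableOn_beta (u := 1) (by simp) hc
      simp only [sub_self, Complex.cpow_zero, one_mul] at this
      exact this.mono_set hsub
    refine Integrable.mul_bdd (c := v ^ (-κ) * ∑' k, S k) hint
      (((continuousOn_kernelSeries_one_sub a a' b b' hc).mono hsub).aestronglyMeasurable
        measurableSet_Ioo) ?_
    filter_upwards [ae_restrict_mem measurableSet_Ioo] with u hu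
    rw [← tsum_mul_left]
    refine tsum_of_norm_bounded (hS.mul_left _).hasSum fun k => ?_
    have h0 : 0 ≤ 1 - u := by linarith [hu.2]
    have := H k (1 - u) h0 (by linarith [hu.1])
    rw [norm_mul, norm_pow, Complex.norm_real, Real.norm_of_nonneg h0]
    refine this.trans (mul_le_mul_of_nonneg_right ?_ (hS0 k))
    rw [sub_sub_cancel]
    exact Real.rpow_le_rpow_of_nonpos hv hu.1.le (by linarith)
  intro y hy
  have hy' : (0 : ℝ) < y := hy
  exact ⟨Ioi (y / 2), mem_nhdsWithin_of_mem_nhds (Ioi_mem_nhds (by linarith)),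
    main _ (by positivity)⟩

theorem msmKernel_isBigO_atTop (a a' b b' c : ℂ) (r : ℝ) :
    msmKernel a a' b b' c =O[Filter.atTop] (fun u : ℝ => u ^ r) := by
  refine (Asymptotics.isBigO_zero _ _).congr' ?_ Filter.EventuallyEq.rfl
  filter_upwards [Filter.eventually_ge_atTop (1 : ℝ)] with u hu
  simp [msmKernel, not_lt.2 hu]

theorem msmKernel_isBigO_zero {a a' b b' c : ℂ} (hc : 0 < c.re) {κ : ℝ} (hκ : 0 < κ)
    (hκ1 : a'.re - b'.re < κ) (hκ2 : a.re + a'.re + b.re - c.re < κ) :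
    msmKernel a a' b b' c =O[nhdsWithin 0 (Ioi 0)] (fun u : ℝ => u ^ (-κ)) := by
  obtain ⟨K, hK⟩ := exists_nat_gt (1 - a'.re)
  obtain ⟨C, -, H⟩ := exists_norm_kernelSeries_le K hc (by linarith) hκ hκ1 hκ2
  have h1 : (fun u : ℝ => ((1 - u : ℝ) : ℂ) ^ (c - 1)) =O[nhdsWithin 0 (Ioi 0)]
      (fun _ : ℝ => (1 : ℝ)) := by
    have : ContinuousAt (fun u : ℝ => ((1 - u : ℝ) : ℂ) ^ (c - 1)) 0 :=
      ContinuousAt.cpow (by fun_prop) continuousAt_const (by simp)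
    exact (this.tendsto.mono_left nhdsWithin_le_nhds).isBigO_one ℝ
  have h2 : (fun u : ℝ => kernelSeries a a' b b' c (1 - u)) =O[nhdsWithin 0 (Ioi 0)]
      (fun u : ℝ => u ^ (-κ)) := by
    refine Asymptotics.IsBigO.of_bound C ?_
    filter_upwards [Ioo_mem_nhdsGT (zero_lt_one (α := ℝ))] with u hu
    have := H (1 - u) (by linarith [hu.2]) (by linarith [hu.1])
    rwa [sub_sub_cancel, ← Real.norm_of_nonneg (Real.rpow_nonneg hu.1.le (-κ))] at this
  have h3 := h1.mul h2
  simp only [one_mul] at h3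
  refine h3.congr' ?_ Filter.EventuallyEq.rfl
  filter_upwards [Ioo_mem_nhdsGT (zero_lt_one (α := ℝ))] with u hu
  simp [msmKernel, hu.2]

theorem exists_lt_and_max_lt {p q r A : ℝ} (h1 : p < A) (h2 : q < A) (h3 : r < A) :
    ∃ κ, p < κ ∧ q < κ ∧ r < κ ∧ κ < A := by
  obtain ⟨κ, hκ, hκA⟩ := exists_between (max_lt h1 (max_lt h2 h3))
  rw [max_lt_iff, max_lt_iff] at hκ
  exact ⟨κ, hκ.1, hκ.2.1, hκ.2.2, hκA⟩

theorem mellinConvergent_msmKernel {a a' b b' c A : ℂ} (hc : 0 < c.re) (hA : 0 < A.re)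
    (hA1 : a'.re - b'.re < A.re) (hA2 : a.re + a'.re + b.re - c.re < A.re) :
    MellinConvergent (msmKernel a a' b b' c) A := by
  obtain ⟨κ, h0, h1, h2, h3⟩ := exists_lt_and_max_lt hA hA1 hA2
  exact mellinConvergent_of_isBigO_rpow (locallyIntegrableOn_msmKernel a a' b b' hc)
    (msmKernel_isBigO_atTop a a' b b' c (-(A.re + 1))) (by linarith)
    (msmKernel_isBigO_zero hc h0 h1 h2) h3

theorem differentiableAt_mellin_msmKernel {a a' b b' c A : ℂ} (hc : 0 < c.re) (hA : 0 < A.re)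
    (hA1 : a'.re - b'.re < A.re) (hA2 : a.re + a'.re + b.re - c.re < A.re) :
    DifferentiableAt ℂ (mellin (msmKernel a a' b b' c)) A := by
  obtain ⟨κ, h0, h1, h2, h3⟩ := exists_lt_and_max_lt hA hA1 hA2
  exact mellin_differentiableAt_of_isBigO_rpow (locallyIntegrableOn_msmKernel a a' b b' hc)
    (msmKernel_isBigO_atTop a a' b b' c (-(A.re + 1))) (by linarith)
    (msmKernel_isBigO_zero hc h0 h1 h2) h3

/-- Termwise Mellin transform of the double series, for `Re A` so large that it converges
absolutely. -/
theorem hasSum_mellin_msmKernel (a a' b b' : ℂ) {c : ℂ} (hc : 0 < c.re) :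
    ∃ R : ℝ, ∀ A : ℂ, R < A.re → HasSum (fun k : ℕ × ℕ => kernelCoeff a a' b b' c k *
      (Complex.Gamma A * Complex.Gamma (c + (k.1 + k.2 : ℕ)) *
        (Complex.Gamma (A + c + (k.1 + k.2 : ℕ)))⁻¹)) (mellin (msmKernel a a' b b' c) A) := by
  obtain ⟨κ, hκ, S, hS, -, H⟩ := exists_crude_bound_kernelCoeff a a' b b' hc
  refine ⟨κ, fun A hA => ?_⟩
  have hA0 : 0 < A.re := hκ.trans hA
  have hA1 : 0 < (A - κ).re := by simpa using hA
  have hcn : ∀ n : ℕ, 0 < (c + n).re := fun n => by simp; positivity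
  have hterm : ∀ (k : ℕ × ℕ), ∀ u ∈ Ioo (0 : ℝ) 1,
      kernelCoeff a a' b b' c k * ((1 - u : ℝ) : ℂ) ^ (k.1 + k.2) *
        ((u : ℂ) ^ (A - 1) * ((1 - u : ℝ) : ℂ) ^ (c - 1)) =
      kernelCoeff a a' b b' c k * ((u : ℂ) ^ (A - 1) *
        ((1 - u : ℝ) : ℂ) ^ (c + (k.1 + k.2 : ℕ) - 1)) := by
    intro k u hu
    have hu0 : ((1 - u : ℝ) : ℂ) ≠ 0 := by exact_mod_cast (sub_pos.2 hu.2).ne'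
    rw [show c + (k.1 + k.2 : ℕ) - 1 = c - 1 + (k.1 + k.2 : ℕ) by ring, Complex.cpow_add _ _ hu0,
      Complex.cpow_natCast]
    ring
  have main := hasSum_integral_of_norm_le_mul (μ := volume.restrict (Ioo 0 1)) (S := S)
    (F := fun k u => kernelCoeff a a' b b' c k * ((1 - u : ℝ) : ℂ) ^ (k.1 + k.2) *
      ((u : ℂ) ^ (A - 1) * ((1 - u : ℝ) : ℂ) ^ (c - 1)))
    (f := fun u => (u : ℂ) ^ (A - 1) *
      (((1 - u : ℝ) : ℂ) ^ (c - 1) * kernelSeries a a' b b' c (1 - u)))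
    (φ := fun u : ℝ => ‖(u : ℂ) ^ (A - κ - 1) * ((1 - u : ℝ) : ℂ) ^ (c - 1)‖)
    (fun k => (by fun_prop : AEStronglyMeasurable (fun u : ℝ =>
      kernelCoeff a a' b b' c k * ((1 - u : ℝ) : ℂ) ^ (k.1 + k.2)) _).mul
        (integrableOn_beta hA0 hc).aestronglyMeasurable)
    hS (integrableOn_beta hA1 hc).norm
    (fun k => by
      filter_upwards [ae_restrict_mem measurableSet_Ioo] with u hu
      have h1u : 0 ≤ 1 - u := by linarith [hu.2]
      have := H k (1 - u) h1u (by linarith [hu.1])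
      rw [sub_sub_cancel] at this
      rw [norm_mul, norm_mul, norm_mul, norm_mul, norm_pow, Complex.norm_real,
        Real.norm_of_nonneg h1u, Complex.norm_cpow_eq_rpow_re_of_pos hu.1,
        Complex.norm_cpow_eq_rpow_re_of_pos hu.1]
      have e : u ^ (A - κ - 1).re = u ^ (-κ) * u ^ (A - 1).re := by
        rw [← Real.rpow_add hu.1]; congr 1; simp; ring
      rw [e]
      calc _ ≤ u ^ (-κ) * S k * (u ^ (A - 1).re * ‖((1 - u : ℝ) : ℂ) ^ (c - 1)‖) := by
            have := Real.rpow_nonneg hu.1.le (A - 1).re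
            gcongr
        _ = _ := by ring)
    (by
      filter_upwards [ae_restrict_mem measurableSet_Ioo] with u hu
      have h := (summable_kernelCoeff a a' b b' hc (w := 1 - u) (by linarith [hu.2])
        (by linarith [hu.1])).hasSum.mul_right ((u : ℂ) ^ (A - 1) * ((1 - u : ℝ) : ℂ) ^ (c - 1))
      convert! h using 1
      rw [kernelSeries]; ring)
  rw [← mellin_msmKernel] at main
  convert! main using 1
  ext k
  rw [setIntegral_congr_fun measurableSet_Ioo (hterm k), integral_const_mul,
    integral_beta hA0 (hcn _), ← add_assoc]

/-- The Mellin multiplier of the operator. Since `Complex.Gamma` vanishes at its poles, each `(Γ z)⁻¹`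
is the entire function `1 / Γ`. -/
noncomputable def msmMultiplier (a a' b b' c s : ℂ) : ℂ :=
  Complex.Gamma (s - c + a + a') * Complex.Gamma (s + a + b' - c) * Complex.Gamma (s - b) *
    ((Complex.Gamma s)⁻¹ * (Complex.Gamma (s - c + a + a' + b'))⁻¹ * (Complex.Gamma (s + a - b))⁻¹)

/-- For `Re s` large the Mellin transform is evaluated by applying Gauss's theorem to the inner and
then to the outer sum. -/
theorem exists_mellin_msmKernel_eq (a a' b b' : ℂ) {c : ℂ} (hc : 0 < c.re) :
    ∃ R : ℝ, ∀ s : ℂ, R < s.re → mellin (msmKernel a a' b b' c) (s - c + a + a') =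
      Complex.Gamma c * msmMultiplier a a' b b' c s := by
  obtain ⟨R₀, H₀⟩ := hasSum_mellin_msmKernel a a' b b' hc
  obtain ⟨M₁, hM₁⟩ := exists_nat_gt (-(c - b').re)
  obtain ⟨M₂, hM₂⟩ := exists_nat_gt (-b.re)
  obtain ⟨R₁, H₁⟩ := hasSum_gauss M₁ a'
  obtain ⟨R₂, H₂⟩ := hasSum_gauss M₂ a
  refine ⟨max (R₀ + (c - a - a').re) (max (R₁ - (a + a' + b' - c).re) (R₂ - (a - b).re)),
    fun s hs => ?_⟩
  rw [max_lt_iff, max_lt_iff] at hs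
  obtain ⟨hs0, hs1, hs2⟩ := hs
  simp only [Complex.sub_re, Complex.add_re] at hs0 hs1 hs2
  set A := s - c + a + a' with hA
  have h₀ := H₀ A (by simp [hA]; linarith)
  have inner : ∀ m : ℕ, HasSum (fun n : ℕ => kernelCoeff a a' b b' c (m, n) *
      (Complex.Gamma A * Complex.Gamma (c + (m + n : ℕ)) *
        (Complex.Gamma (A + c + (m + n : ℕ)))⁻¹))
      (Complex.Gamma A * Complex.Gamma c * Complex.Gamma (s + a + b' - c) *
        (Complex.Gamma (s - c + a + a' + b'))⁻¹ * (poch a m * poch b m / (m.factorial : ℂ) *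
          (Complex.Gamma (s + a + m))⁻¹)) := by
    intro m
    have h := (H₁ (c - b' + m) (A + c + m) (by
        simp at hM₁ ⊢; linarith [Nat.cast_nonneg (α := ℝ) m]) (by
        simp [hA]; linarith)).mul_left
          (Complex.Gamma A * Complex.Gamma c * (poch a m * poch b m / (m.factorial : ℂ)))
    convert! h using 1
    · ext n
      have hp := poch_ne_zero hc (m + n)
      have hm : (m.factorial : ℂ) ≠ 0 := by exact_mod_cast m.factorial_ne_zero
      have hn : (n.factorial : ℂ) ≠ 0 := by exact_mod_cast n.factorial_ne_zero
      rw [Gamma_add_nat hc, kernelCoeff, show A + c + ((m + n : ℕ) : ℂ) = A + c + m + n by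
        push_cast; ring]
      field_simp
    · rw [show A + c + m - a' - (c - b' + m) = s + a + b' - c by rw [hA]; ring,
        show A + c + m - a' = s + a + m by rw [hA]; ring,
        show A + c + m - (c - b' + m) = s - c + a + a' + b' by rw [hA]; ring]
      ring
  have outer := (H₂ b (s + a) (by linarith) (by simp; linarith)).mul_left
    (Complex.Gamma A * Complex.Gamma c * Complex.Gamma (s + a + b' - c) *
        (Complex.Gamma (s - c + a + a' + b'))⁻¹)
  rw [(h₀.prod_fiberwise inner).unique outer, msmMultiplier,
    show s + a - a - b = s - b by ring, show s + a - a = s by ring]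
  ring

theorem differentiableAt_Gamma_of_re_pos {z : ℂ} (hz : 0 < z.re) :
    DifferentiableAt ℂ Complex.Gamma z := by
  refine Complex.differentiableAt_Gamma z fun m h => ?_
  rw [h] at hz
  simp at hz
  linarith [Nat.cast_nonneg (α := ℝ) m]

theorem differentiableAt_msmMultiplier {a a' b b' c s : ℂ} (h1 : 0 < (s - c + a + a').re)
    (h2 : 0 < (s + a + b' - c).re) (h3 : 0 < (s - b).re) :
    DifferentiableAt ℂ (msmMultiplier a a' b b' c) s := by
  have g1 : DifferentiableAt ℂ (fun s : ℂ => Complex.Gamma (s - c + a + a')) s :=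
    (differentiableAt_Gamma_of_re_pos h1).comp s (by fun_prop)
  have g2 : DifferentiableAt ℂ (fun s : ℂ => Complex.Gamma (s + a + b' - c)) s :=
    (differentiableAt_Gamma_of_re_pos h2).comp s (by fun_prop)
  have g3 : DifferentiableAt ℂ (fun s : ℂ => Complex.Gamma (s - b)) s :=
    (differentiableAt_Gamma_of_re_pos h3).comp s (by fun_prop)
  have i := Complex.differentiable_one_div_Gamma
  have g4 : DifferentiableAt ℂ (fun s : ℂ => (Complex.Gamma s)⁻¹) s := i s
  have g5 : DifferentiableAt ℂ (fun s : ℂ => (Complex.Gamma (s - c + a + a' + b'))⁻¹) s :=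
    (i _).comp s (by fun_prop)
  have g6 : DifferentiableAt ℂ (fun s : ℂ => (Complex.Gamma (s + a - b))⁻¹) s :=
    (i _).comp s (by fun_prop)
  exact ((g1.mul g2).mul g3).mul ((g4.mul g5).mul g6)

/-- The Mellin transform of the kernel on the whole half-plane of convergence, by analytic
continuation in `s`. -/
theorem hasMellin_msmKernel {a a' b b' c s : ℂ} (hc : 0 < c.re) (h1 : 0 < (s - c + a + a').re)
    (h2 : 0 < (s + a + b' - c).re) (h3 : 0 < (s - b).re) :
    HasMellin (msmKernel a a' b b' c) (s - c + a + a')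
      (Complex.Gamma c * msmMultiplier a a' b b' c s) := by
  have conv : ∀ {z : ℂ}, 0 < (z - c + a + a').re → 0 < (z + a + b' - c).re → 0 < (z - b).re →
      a'.re - b'.re < (z - c + a + a').re ∧
        a.re + a'.re + b.re - c.re < (z - c + a + a').re := by
    intro z _ h h'
    simp only [Complex.sub_re, Complex.add_re] at h h' ⊢
    constructor <;> linarith
  refine ⟨mellinConvergent_msmKernel hc h1 (conv h1 h2 h3).1 (conv h1 h2 h3).2, ?_⟩
  set σ : ℝ := max (c - a - a').re (max (c - a - b').re b.re) with hσ
  set U : Set ℂ := {z | σ < z.re} with hU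
  have memU : ∀ z : ℂ, z ∈ U ↔
      0 < (z - c + a + a').re ∧ 0 < (z + a + b' - c).re ∧ 0 < (z - b).re := by
    intro z
    simp only [hU, hσ, mem_ofPred_eq, max_lt_iff, Complex.sub_re, Complex.add_re]
    constructor <;> rintro ⟨p, q, r⟩ <;> refine ⟨?_, ?_, ?_⟩ <;> linarith
  have hUo : IsOpen U := isOpen_lt continuous_const Complex.continuous_re
  have hf : AnalyticOnNhd ℂ (fun z => mellin (msmKernel a a' b b' c) (z - c + a + a')) U := by
    refine DifferentiableOn.analyticOnNhd (fun z hz => ?_) hUo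
    obtain ⟨p, q, r⟩ := (memU z).1 hz
    exact ((differentiableAt_mellin_msmKernel hc p (conv p q r).1 (conv p q r).2).comp z
      (by fun_prop : DifferentiableAt ℂ (fun z => z - c + a + a') z)).differentiableWithinAt
  have hg : AnalyticOnNhd ℂ (fun z => Complex.Gamma c * msmMultiplier a a' b b' c z) U := by
    refine DifferentiableOn.analyticOnNhd (fun z hz => ?_) hUo
    obtain ⟨p, q, r⟩ := (memU z).1 hz
    exact ((differentiableAt_msmMultiplier p q r).const_mul _).differentiableWithinAt
  obtain ⟨R, HR⟩ := exists_mellin_msmKernel_eq a a' b b' hc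
  have hz₀ : (((max R σ + 1 : ℝ) : ℂ)) ∈ U := by
    simp only [hU, mem_ofPred_eq, Complex.ofReal_re]; linarith [le_max_right R σ]
  refine hf.eqOn_of_preconnected_of_eventuallyEq hg
    (convex_halfSpace_re_gt σ).isPreconnected hz₀ ?_ ((memU s).2 ⟨h1, h2, h3⟩)
  have : {z : ℂ | R < z.re} ∈ nhds (((max R σ + 1 : ℝ) : ℂ)) :=
    (isOpen_lt continuous_const Complex.continuous_re).mem_nhds (by
      simp only [mem_ofPred_eq, Complex.ofReal_re]; linarith [le_max_left R σ])
  filter_upwards [this] with z hz using HR z hz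

/-! ### Images of powers and of power series in `1 / t` -/

theorem msmIntegrand_cpow (a a' b b' : ℂ) {c : ℂ} (hc : 0 < c.re) (p : ℂ) {x t : ℝ} (hx : 0 < x)
    (ht : x < t) :
    msmIntegrand a a' b b' c (fun t => (t : ℂ) ^ p) x t =
      (x : ℂ) ^ a' * ((t : ℂ) ^ (-(-p - c + a + a') - 1) * msmKernel a a' b b' c (x * t⁻¹)) := by
  have ht0 : 0 < t := hx.trans ht
  have htc : (t : ℂ) ≠ 0 := by exact_mod_cast ht0.ne'
  have hu1 : x * t⁻¹ < 1 := by rw [← div_eq_mul_inv]; exact (div_lt_one ht0).2 ht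
  rw [msmIntegrand, appellF3_eq_kernelSeries a a' b b' hc hx ht, msmKernel, if_pos hu1]
  have e1 : ((1 - x * t⁻¹ : ℝ) : ℂ) ^ (c - 1) =
      ((t - x : ℝ) : ℂ) ^ (c - 1) * (t : ℂ) ^ (-(c - 1)) := by
    have : t - x = t * (1 - x * t⁻¹) := by field_simp
    rw [this, Complex.ofReal_mul, Complex.mul_cpow_ofReal_nonneg ht0.le (by linarith),
      mul_right_comm, ← Complex.cpow_add _ _ htc]
    simp
  have e2 : ((x / t : ℝ) : ℂ) ^ a' = (x : ℂ) ^ a' * (t : ℂ) ^ (-a') := by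
    have : x = t * (x / t) := by field_simp
    conv_rhs => rw [this, Complex.ofReal_mul, Complex.mul_cpow_ofReal_nonneg ht0.le (by positivity),
      mul_comm, ← mul_assoc, ← Complex.cpow_add _ _ htc]
    simp
  have e3 : (t : ℂ) ^ (-(-p - c + a + a') - 1) * (t : ℂ) ^ (-(c - 1)) =
      (t : ℂ) ^ (-a) * (t : ℂ) ^ (-a') * (t : ℂ) ^ p := by
    rw [← Complex.cpow_add _ _ htc, ← Complex.cpow_add _ _ htc, ← Complex.cpow_add _ _ htc]
    congr 1; ring
  rw [e1, e2, ← div_eq_mul_inv]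
  linear_combination (-(x : ℂ) ^ a' * ((t - x : ℝ) : ℂ) ^ (c - 1) *
    kernelSeries a a' b b' c (1 - x / t)) * e3

theorem setIntegral_Ioi_eq_of_eqOn_zero {f g : ℝ → ℂ} {x : ℝ} (hx : 0 < x)
    (hfg : ∀ t ∈ Ioi x, f t = g t) (hg : ∀ t ∈ Ioc 0 x, g t = 0) :
    (IntegrableOn g (Ioi 0) → IntegrableOn f (Ioi x)) ∧ ∫ t in Ioi x, f t = ∫ t in Ioi 0, g t := by
  refine ⟨fun h => (h.mono_set (Ioi_subset_Ioi hx.le)).congr_fun (fun t ht => (hfg t ht).symm)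
    measurableSet_Ioi, ?_⟩
  rw [setIntegral_congr_fun measurableSet_Ioi hfg]
  refine (setIntegral_eq_of_subset_of_forall_sdiff_eq_zero measurableSet_Ioi
    (Ioi_subset_Ioi hx.le) fun t ht => hg t ⟨ht.1, not_lt.1 ht.2⟩).symm

/-- The image of a power `t ^ p`, before normalisation: the substitution `t = x / u` turns the
integral into the Mellin transform of the kernel. -/
theorem msmIntegrand_cpow_integral {a a' b b' c p : ℂ} (hc : 0 < c.re)
    (h1 : 0 < (-p - c + a + a').re) (h2 : 0 < (-p + a + b' - c).re) (h3 : 0 < (-p - b).re)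
    {x : ℝ} (hx : 0 < x) :
    IntegrableOn (msmIntegrand a a' b b' c (fun t => (t : ℂ) ^ p) x) (Ioi x) ∧
      ∫ t in Ioi x, msmIntegrand a a' b b' c (fun t => (t : ℂ) ^ p) x t =
        (x : ℂ) ^ a' * ((x : ℂ) ^ (-(-p - c + a + a')) *
          (Complex.Gamma c * msmMultiplier a a' b b' c (-p))) := by
  obtain ⟨hconv, hval⟩ := hasMellin_msmKernel hc h1 h2 h3
  set A := -p - c + a + a'
  have hc1 : MellinConvergent (fun t => msmKernel a a' b b' c (x * t⁻¹)) (-A) := by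
    have h := (MellinConvergent.comp_mul_left (f := msmKernel a a' b b' c) (s := A) hx).2 hconv
    have := (MellinConvergent.comp_rpow (f := fun t => msmKernel a a' b b' c (x * t)) (s := -A)
      (a := -1) (by norm_num)).2 (by simpa using h)
    simpa only [Real.rpow_neg_one] using this
  have hv1 : mellin (fun t => msmKernel a a' b b' c (x * t⁻¹)) (-A) =
      (x : ℂ) ^ (-A) * (Complex.Gamma c * msmMultiplier a a' b b' c (-p)) := by
    rw [mellin_comp_inv (fun t => msmKernel a a' b b' c (x * t)), neg_neg,
      mellin_comp_mul_left _ _ hx, hval, smul_eq_mul]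
  have hz : ∀ t ∈ Ioc 0 x, (x : ℂ) ^ a' * ((t : ℂ) ^ (-A - 1) *
      msmKernel a a' b b' c (x * t⁻¹)) = 0 := by
    intro t ht
    have : ¬ x * t⁻¹ < 1 := by
      rw [← div_eq_mul_inv, not_lt]; exact (one_le_div ht.1).2 ht.2
    rw [msmKernel, if_neg this, mul_zero, mul_zero]
  obtain ⟨g1, g2⟩ := setIntegral_Ioi_eq_of_eqOn_zero hx
    (fun t ht => msmIntegrand_cpow a a' b b' hc p hx ht) hz
  refine ⟨g1 (Integrable.const_mul hc1 _), ?_⟩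
  rw [g2, integral_const_mul, ← hv1]
  rfl

theorem integrable_of_hasSum_norm_le_mul {μ : Measure ℝ}
    {F : ℕ → ℝ → ℂ} {f : ℝ → ℂ} {φ : ℝ → ℝ} {S : ℕ → ℝ} (hF : ∀ i, AEStronglyMeasurable (F i) μ)
    (hS : Summable S) (hφ : Integrable φ μ) (hle : ∀ i, ∀ᵐ t ∂μ, ‖F i t‖ ≤ S i * φ t)
    (hf : ∀ᵐ t ∂μ, HasSum (fun i => F i t) (f t)) : Integrable f μ := by
  refine (hφ.const_mul (∑' i, S i)).mono' ?_ ?_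
  · refine aestronglyMeasurable_of_tendsto_ae Filter.atTop
      (f := fun n t => ∑ i ∈ Finset.range n, F i t)
      (fun n => Finset.aestronglyMeasurable_fun_sum _ fun i _ => hF i) ?_
    filter_upwards [hf] with t ht using ht.tendsto_sum_nat
  · filter_upwards [hf, ae_all_iff.2 hle] with t ht hl
    exact ht.norm_le_of_bounded (hS.hasSum.mul_right _) hl

theorem Gamma_three_halves_add (k : ℕ) :
    Complex.Gamma (3 / 2 + k) * 4 ^ k * (k.factorial : ℂ) * 2 =
      (Real.sqrt Real.pi : ℂ) * ((2 * k + 1).factorial : ℂ) := by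
  induction k with
  | zero =>
    have h1 : Complex.Gamma (1 / 2) = (Real.sqrt Real.pi : ℂ) := by
      rw [← Real.Gamma_one_half_eq, ← Complex.Gamma_ofReal]; push_cast; rfl
    have h2 : Complex.Gamma (3 / 2) = 1 / 2 * Complex.Gamma (1 / 2) := by
      rw [← Complex.Gamma_add_one _ (by norm_num)]; norm_num
    rw [Nat.cast_zero, add_zero, h2, h1]
    simp
    ring
  | succ k ih =>
    have hne : (3 / 2 + k : ℂ) ≠ 0 := ne_zero_of_re_pos (by
      have : ((3 : ℂ) / 2 + k).re = 3 / 2 + k := by simp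
      rw [this]; positivity)
    rw [Nat.cast_succ, ← add_assoc, Complex.Gamma_add_one _ hne,
      show 2 * (k + 1) + 1 = (2 * k + 1 + 1) + 1 by ring, Nat.factorial_succ (2 * k + 1 + 1),
      Nat.factorial_succ (2 * k + 1), Nat.factorial_succ k]
    push_cast
    linear_combination ((2 * k + 2 : ℂ) * (2 * k + 3)) * ih

/-- The `k`-th term of the Wright series as the image of the `k`-th power. -/
theorem wrightTerm_eq (a a' b b' c p y : ℂ) {x : ℝ} (hx : 0 < x) (k : ℕ) :
    (Real.sqrt Real.pi : ℂ) / 2 * (x : ℂ) ^ (p - a - a' + c) *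
      wrightTerm (upperParams a a' b b' c (-p)) (lowerParams a a' b b' c (-p))
        (y / (4 * (x : ℂ) ^ 2)) k =
    y ^ k / ((2 * k + 1).factorial : ℂ) * ((x : ℂ) ^ (-(-(p - 2 * k) - c + a + a')) *
      msmMultiplier a a' b b' c (-(p - 2 * k))) := by
  have hxc : (x : ℂ) ≠ 0 := by exact_mod_cast hx.ne'
  have e1 : (x : ℂ) ^ (-(-(p - 2 * k) - c + a + a')) =
      (x : ℂ) ^ (p - a - a' + c) * (((x : ℂ) ^ 2) ^ k)⁻¹ := by
    rw [show -(-(p - 2 * k) - c + a + a') = (p - a - a' + c) - ((2 * k : ℕ) : ℂ) by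
      push_cast; ring, Complex.cpow_sub _ _ hxc, Complex.cpow_natCast, pow_mul, div_eq_mul_inv]
  have hG : Complex.Gamma (3 / 2 + k) ≠ 0 := Complex.Gamma_ne_zero_of_re_pos (by
      have : ((3 : ℂ) / 2 + k).re = 3 / 2 + k := by simp
      rw [this]; positivity)
  have hk : (k.factorial : ℂ) ≠ 0 := by exact_mod_cast k.factorial_ne_zero
  have hk2 : ((2 * k + 1).factorial : ℂ) ≠ 0 := by exact_mod_cast (2 * k + 1).factorial_ne_zero
  have e2 : (Real.sqrt Real.pi : ℂ) / 2 * (Complex.Gamma (3 / 2 + k))⁻¹ * (4 ^ k)⁻¹ *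
      (k.factorial : ℂ)⁻¹ = ((2 * k + 1).factorial : ℂ)⁻¹ := by
    rw [← mul_inv_cancel_right₀ hk2 (Real.sqrt Real.pi : ℂ), ← Gamma_three_halves_add k]
    generalize Complex.Gamma (3 / 2 + k) = g at hG
    field_simp
  rw [wrightTerm, Fin.prod_univ_three, Fin.prod_univ_four, e1, msmMultiplier]
  simp only [upperParams, lowerParams, Matrix.cons_val, Complex.ofReal_ofNat, Complex.ofReal_one,
    one_mul]
  rw [div_eq_mul_inv (y ^ k), ← e2, div_pow, mul_pow,
    show -(p - 2 * (k : ℂ)) - c + a + a' = -p - c + a + a' + 2 * k by ring,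
    show -(p - 2 * (k : ℂ)) + a + b' - c = -p + a + b' - c + 2 * k by ring,
    show -(p - 2 * (k : ℂ)) - b = -p - b + 2 * k by ring,
    show -(p - 2 * (k : ℂ)) = -p + 2 * k by ring,
    show -p - c + a + a' + 2 * (k : ℂ) + b' = -p - c + a + a' + b' + 2 * k by ring,
    show -p + 2 * (k : ℂ) + a - b = -p + a - b + 2 * k by ring]
  simp only [div_eq_mul_inv, mul_inv]
  ring

theorem summable_pow_div_odd_factorial (r : ℝ) (hr : 0 ≤ r) :
    Summable fun k : ℕ => r ^ k / ((2 * k + 1).factorial : ℝ) := by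
  refine Summable.of_nonneg_of_le (fun k => by positivity) (fun k => ?_)
    (Real.summable_pow_div_factorial r)
  have : (k.factorial : ℝ) ≤ (2 * k + 1).factorial := by
    exact_mod_cast Nat.factorial_le (by omega)
  gcongr

/-- The image of the function `c t ^ p ∑ y ^ k t ^ (-2 k) / (2 k + 1)!`. -/
theorem hasMsmImage_of_hasSum {a a' b b' γ p c y : ℂ} (hγ : 0 < γ.re)
    (h1 : 0 < (-p - γ + a + a').re) (h2 : 0 < (-p + a + b' - γ).re) (h3 : 0 < (-p - b).re)
    {x : ℝ} (hx : 0 < x) {f : ℝ → ℂ} (hf : ∀ t : ℝ, x < t → HasSum (fun k : ℕ =>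
      c * (y ^ k / ((2 * k + 1).factorial : ℂ) * (t : ℂ) ^ (p - 2 * k))) (f t)) :
    HasMsmImage a a' b b' γ f x
      (c / 2 * (Real.sqrt Real.pi : ℂ) * (x : ℂ) ^ (p - a - a' + γ)) (-p)
      (y / (4 * (x : ℂ) ^ 2)) := by
  set Φ := msmIntegrand a a' b b' γ (fun t => (t : ℂ) ^ p) x with hΦ
  set q : ℕ → ℂ := fun k => y ^ k / ((2 * k + 1).factorial : ℂ) with hq
  have hxc : (x : ℂ) ≠ 0 := by exact_mod_cast hx.ne'
  have hpow := fun k : ℕ => msmIntegrand_cpow_integral (a := a) (a' := a') (b := b) (b' := b')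
    (c := γ) (p := p - 2 * k) (x := x) hγ (by simp at h1 ⊢; linarith [Nat.cast_nonneg (α := ℝ) k])
    (by simp at h2 ⊢; linarith [Nat.cast_nonneg (α := ℝ) k])
    (by simp at h3 ⊢; linarith [Nat.cast_nonneg (α := ℝ) k]) hx
  have hΦi : IntegrableOn Φ (Ioi x) := by simpa using (hpow 0).1
  set F : ℕ → ℝ → ℂ := fun k t =>
    q k * msmIntegrand a a' b b' γ (fun t => (t : ℂ) ^ (p - 2 * k)) x t with hF
  have hFΦ : ∀ k, ∀ t ∈ Ioi x, F k t = q k * ((((t : ℂ) ^ 2) ^ k)⁻¹ * Φ t) := by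
    intro k t ht
    have htc : (t : ℂ) ≠ 0 := by exact_mod_cast (hx.trans ht).ne'
    have : (t : ℂ) ^ (p - 2 * k) = (t : ℂ) ^ p * (((t : ℂ) ^ 2) ^ k)⁻¹ := by
      rw [show p - 2 * (k : ℂ) = p - ((2 * k : ℕ) : ℂ) by push_cast; ring,
        Complex.cpow_sub _ _ htc, Complex.cpow_natCast, pow_mul, div_eq_mul_inv]
    simp only [hF, hΦ, msmIntegrand, this]
    ring
  set S : ℕ → ℝ := fun k => (‖y‖ / x ^ 2) ^ k / ((2 * k + 1).factorial : ℝ) with hS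
  have hSs : Summable S := summable_pow_div_odd_factorial _ (by positivity)
  have hle : ∀ k, ∀ t ∈ Ioi x, ‖F k t‖ ≤ S k * ‖Φ t‖ := by
    intro k t ht
    have ht' : x < t := ht
    have ht0 : 0 < t := hx.trans ht
    rw [hFΦ k t ht, ← mul_assoc, norm_mul]
    refine mul_le_mul_of_nonneg_right ?_ (norm_nonneg _)
    simp only [hq, hS, norm_mul, norm_div, norm_inv, norm_pow, Complex.norm_natCast,
      Complex.norm_real, Real.norm_of_nonneg ht0.le, div_pow]
    rw [div_mul_eq_mul_div]
    gcongr
    rw [← div_eq_mul_inv]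
    gcongr
  have hFm : ∀ k, AEStronglyMeasurable (F k) (volume.restrict (Ioi x)) := fun k =>
    ((hpow k).1.const_mul (q k)).aestronglyMeasurable
  have hleae : ∀ k, ∀ᵐ t ∂(volume.restrict (Ioi x)), ‖F k t‖ ≤ S k * ‖Φ t‖ := fun k => by
    filter_upwards [ae_restrict_mem measurableSet_Ioi] with t ht using hle k t ht
  set G : ℝ → ℂ := fun t => ∑' k, F k t with hG
  have hGs : ∀ t ∈ Ioi x, HasSum (fun k => F k t) (G t) := fun t ht =>
    (Summable.of_norm_bounded (hSs.mul_right _) fun k => hle k t ht).hasSum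
  have hGae : ∀ᵐ t ∂(volume.restrict (Ioi x)), HasSum (fun k => F k t) (G t) := by
    filter_upwards [ae_restrict_mem measurableSet_Ioi] with t ht using hGs t ht
  have hGi := integrable_of_hasSum_norm_le_mul hFm hSs hΦi.norm hleae hGae
  have hsum := hasSum_integral_of_norm_le_mul hFm hSs hΦi.norm hleae hGae
  have hfG : ∀ t ∈ Ioi x, msmIntegrand a a' b b' γ f x t = c * G t := by
    intro t ht
    have e1 := (hGs t ht).mul_left c
    have e2 := (hf t ht).mul_left (((t - x : ℝ) : ℂ) ^ (γ - 1) * (t : ℂ) ^ (-a) *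
      appellF3 a a' b b' γ ((1 - x / t : ℝ) : ℂ) ((1 - t / x : ℝ) : ℂ))
    refine e2.unique ?_
    convert! e1 using 1
    ext k
    simp only [hF, hq, msmIntegrand]
    ring
  have hΓ : Complex.Gamma γ ≠ 0 := Complex.Gamma_ne_zero_of_re_pos hγ
  have hxa : (x : ℂ) ^ a' ≠ 0 := by simp [hxc]
  -- `c` is kept out of the constant, so that the Wright series converges also for `c = 0`.
  set K : ℂ := (Real.sqrt Real.pi : ℂ) / 2 * (x : ℂ) ^ (p - a - a' + γ) with hK
  have hK0 : K ≠ 0 := by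
    have : (Real.sqrt Real.pi : ℂ) ≠ 0 := by
      exact_mod_cast (Real.sqrt_pos.2 Real.pi_pos).ne'
    simp [hK, hxc, this]
  have hFint : ∀ k, ∫ t in Ioi x, F k t = (x : ℂ) ^ a' * Complex.Gamma γ * (K *
      wrightTerm (upperParams a a' b b' γ (-p)) (lowerParams a a' b b' γ (-p))
        (y / (4 * (x : ℂ) ^ 2)) k) := by
    intro k
    simp only [hF]
    rw [integral_const_mul, (hpow k).2, hK, wrightTerm_eq a a' b b' γ p y hx k]
    ring
  simp_rw [hFint] at hsum
  have hw : HasSum (wrightTerm (upperParams a a' b b' γ (-p)) (lowerParams a a' b b' γ (-p))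
      (y / (4 * (x : ℂ) ^ 2))) (((x : ℂ) ^ a' * Complex.Gamma γ * K)⁻¹ * ∫ t in Ioi x, G t) := by
    convert! hsum.mul_left ((x : ℂ) ^ a' * Complex.Gamma γ * K)⁻¹ using 1
    ext k
    field_simp
  refine ⟨?_, hw.summable, ?_⟩
  · exact (Integrable.const_mul hGi c).congr
      ((ae_restrict_mem measurableSet_Ioi).mono fun t ht => (hfG t ht).symm)
  · rw [msmRight, setIntegral_congr_fun measurableSet_Ioi hfG, integral_const_mul, wrightPsi,
      hw.tsum_eq, Complex.cpow_neg, show c / 2 * (Real.sqrt Real.pi : ℂ) *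
        (x : ℂ) ^ (p - a - a' + γ) = c * K by rw [hK]; ring]
    field_simp

/-! ### Sine and hyperbolic sine -/

theorem hasSum_cpow_mul_sin (p c : ℂ) {t : ℝ} (ht : 0 < t) :
    HasSum (fun k : ℕ => c * ((-c ^ 2) ^ k / ((2 * k + 1).factorial : ℂ) * (t : ℂ) ^ (p - 2 * k)))
      ((t : ℂ) ^ (p + 1) * Complex.sin (c / t)) := by
  have htc : (t : ℂ) ≠ 0 := by exact_mod_cast ht.ne'
  convert! (Complex.hasSum_sin (c / t)).mul_left ((t : ℂ) ^ (p + 1)) using 1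
  ext k
  rw [show p - 2 * (k : ℂ) = p - ((2 * k : ℕ) : ℂ) by push_cast; ring,
    Complex.cpow_sub _ _ htc, Complex.cpow_natCast, Complex.cpow_add _ _ htc, Complex.cpow_one,
    neg_pow, div_pow, pow_succ c (2 * k), pow_succ (t : ℂ), pow_mul c]
  field_simp

theorem hasSum_cpow_mul_sinh (p c : ℂ) {t : ℝ} (ht : 0 < t) :
    HasSum (fun k : ℕ => c * ((c ^ 2) ^ k / ((2 * k + 1).factorial : ℂ) * (t : ℂ) ^ (p - 2 * k)))
      ((t : ℂ) ^ (p + 1) * Complex.sinh (c / t)) := by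
  have htc : (t : ℂ) ≠ 0 := by exact_mod_cast ht.ne'
  convert! (Complex.hasSum_sinh (c / t)).mul_left ((t : ℂ) ^ (p + 1)) using 1
  ext k
  rw [show p - 2 * (k : ℂ) = p - ((2 * k : ℕ) : ℂ) by push_cast; ring,
    Complex.cpow_sub _ _ htc, Complex.cpow_natCast, Complex.cpow_add _ _ htc, Complex.cpow_one,
    div_pow, pow_succ c (2 * k), pow_succ (t : ℂ), pow_mul c]
  field_simp

theorem mainTheorem10 (α α' β β' γ ρ c : ℂ) (x : ℝ) (hx : 0 < x) (hγ : 0 < γ.re)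
    (hρ : ρ.re < min (-β).re (min (α + α' - γ).re (α + β' - γ).re)) :
    HasMsmImage α α' β β' γ (fun t : ℝ => (t : ℂ) ^ (ρ + 1) * Complex.sin (c / t)) x
      (c / 2 * (Real.sqrt Real.pi : ℂ) * (x : ℂ) ^ (ρ - α - α' + γ))
      (-ρ) (-(c ^ 2 / (4 * (x : ℂ) ^ 2))) ∧
    HasMsmImage α α' β β' γ (fun t : ℝ => (t : ℂ) ^ (ρ + 1) * Complex.sinh (c / t)) x
      (c / 2 * (Real.sqrt Real.pi : ℂ) * (x : ℂ) ^ (ρ - α - α' + γ))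
      (-ρ) (c ^ 2 / (4 * (x : ℂ) ^ 2)) ∧
    HasMsmImage α α' β β' γ (fun t : ℝ => (t : ℂ) ^ (ρ - 1) * Complex.sin (c / t)) x
      (c / 2 * (Real.sqrt Real.pi : ℂ) * (x : ℂ) ^ (ρ - 2 - α - α' + γ))
      (2 - ρ) (-(c ^ 2 / (4 * (x : ℂ) ^ 2))) ∧
    HasMsmImage α α' β β' γ (fun t : ℝ => (t : ℂ) ^ ρ * Complex.sinh (c / t)) x
      (c / 2 * (Real.sqrt Real.pi : ℂ) * (x : ℂ) ^ (ρ - 1 - α - α' + γ))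
      (1 - ρ) (c ^ 2 / (4 * (x : ℂ) ^ 2)) := by
  rw [lt_min_iff, lt_min_iff] at hρ
  simp only [Complex.neg_re, Complex.sub_re, Complex.add_re] at hρ
  obtain ⟨r1, r2, r3⟩ := hρ
  -- The hypotheses on `ρ` persist for every power with a smaller real part.
  have image : ∀ (p y : ℂ) (f : ℝ → ℂ), p.re ≤ ρ.re → (∀ t : ℝ, x < t → HasSum (fun k : ℕ =>
      c * (y ^ k / ((2 * k + 1).factorial : ℂ) * (t : ℂ) ^ (p - 2 * k))) (f t)) →
      HasMsmImage α α' β β' γ f x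
        (c / 2 * (Real.sqrt Real.pi : ℂ) * (x : ℂ) ^ (p - α - α' + γ)) (-p)
        (y / (4 * (x : ℂ) ^ 2)) := fun p y f hp hf =>
    hasMsmImage_of_hasSum hγ (by simp; linarith) (by simp; linarith) (by simp; linarith) hx hf
  refine ⟨?_, ?_, ?_, ?_⟩
  · rw [← neg_div]
    exact image ρ _ _ le_rfl fun t ht => hasSum_cpow_mul_sin ρ c (hx.trans ht)
  · exact image ρ _ _ le_rfl fun t ht => hasSum_cpow_mul_sinh ρ c (hx.trans ht)
  · rw [← neg_div, show (2 : ℂ) - ρ = -(ρ - 2) by ring]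
    refine image (ρ - 2) _ _ (by simp) fun t ht => ?_
    have := hasSum_cpow_mul_sin (ρ - 2) c (hx.trans ht)
    rwa [show ρ - 2 + 1 = ρ - 1 by ring] at this
  · rw [show (1 : ℂ) - ρ = -(ρ - 1) by ring]
    refine image (ρ - 1) _ _ (by simp) fun t ht => ?_
    have := hasSum_cpow_mul_sinh (ρ - 1) c (hx.trans ht)
    rwa [sub_add_cancel] at this
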